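/- Let $\mathbb{F}$ be a finite field of characteristic $p$, and let $\mathbb{F}((t^{-1}))$ be the completion of $\mathbb{F}(t)$ at the place at infinity. For a monic $Q\in\mathbb{F}[t]$ put $\mathbb{F}[t]_Q=\mathbb{F}[t]/Q\mathbb{F}[t]$. Put $|m|=|\mathbb{F}|^{\deg m}$ for $0\ne m\in\mathbb{F}[t]$, and let $\mathrm{lpf}(Q)$ be the minimum of $|R|$ over the monic irreducible factors $R$ of $Q$ (for $Q=1$ there are none, and $1/\mathrm{lpf}(Q)$ is read as $0$). For a finite non-empty set $S$ and $g:S\to\mathbb{C}$ write $\mathbb{E}_{x\in S}\,g(x)=\frac1{|S|}\sum_{x\in S}g(x)$ and $\|g\|_{L^2(S)}=\left(\mathbb{E}_{x\in S}|g(x)|^2\right)^{1/2}$. A polynomial $\eta$ over $\mathbb{F}((t^{-1}))$ is *additive* if $\eta(x+y)=\eta(x)+\eta(y)$ for all $x,y\in\mathbb{F}((t^{-1}))$. With $\partial_u g(x)=g(x+u)-g(x)$ and $\partial_{u_1,\dots,u_m}=\partial_{u_m}\cdots\partial_{u_1}$, the *derivational degree* of $P\in\mathbb{F}((t^{-1}))[y]$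 is the least $m\ge 0$ such that $\partial_{u_1,\dots,u_{m+1}}P(y)=0$ for all $u_1,\dots,u_{m+1},y\in\mathbb{F}((t^{-1}))$. **Theorem.** Let $P(y)\in(\mathbb{F}[t])[y]$ be a nonconstant polynomial of degree $d$ and derivational degree $k$. Write $P(y)=a_0+\sum_{i=1}^n\eta_i(y^{r_i})$, where $a_0\in\mathbb{F}[t]$, the $\eta_i\in(\mathbb{F}[t])[y]$ are additive polynomials, and the $r_i$ are distinct natural numbers not divisible by $p$. Let $H=\sum_{i=1}^n\eta_i(\mathbb{F}[t])$, and for monic $Q\in\mathbb{F}[t]$ let $H_Q=\{z \bmod Q: z\in H\}$. Then for every monic $Q\in\mathbb{F}[t]$ and every $f:\mathbb{F}[t]_Q\to\mathbb{C}$, $$\left\|\mathbb{E}_{y\in\mathbb{F}[t]_Q}f(x+P(y))-\mathbb{E}_{z\in H_Q}f(x+a_0+z)\right\|_{L^2(\mathbb{F}[t]_Q)}\le\left(p^{2\lfloor\log_p d\rfloor}\,\frac{k-1}{\mathrm{lpf}(Q)}\right)^{1/2^{k-1}}\|f\|_{L^2(\mathbb{F}[t]_Q)},$$ where the norm on the left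 is taken in the variable $x\in\mathbb{F}[t]_Q$. -/

import Mathlib

open Polynomial

namespace PolyWeyl

/-! Averages and norms on finite sets. -/

/-- The average `𝔼_{x ∈ S} f x = |S|⁻¹ ∑_{x ∈ S} f x` over a finite set `S`. -/
noncomputable def avg {α 𝕜 : Type*} [Field 𝕜] (S : Set α) (f : α → 𝕜) : 𝕜 :=
  (S.ncard : 𝕜)⁻¹ * ∑ᶠ x ∈ S, f x

/-- The `L^r` norm `(𝔼_{x ∈ α} |f x|^r)^{1/r}` on a finite set `α`, for the uniform probability
measure. -/
noncomputable def lrNorm {α : Type*} (r : ℝ) (f : α → ℂ) : ℝ :=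
  (avg Set.univ (fun x => ‖f x‖ ^ r)) ^ (1 / r)

/-! Polynomials over a field: additive polynomials and the derivational degree. -/

/-- `η` is an additive polynomial over `K`: `η (x + y) = η x + η y` for all `x, y ∈ K`. -/
def IsAdditive {K : Type*} [Field K] (η : K[X]) : Prop :=
  ∀ x y : K, η.eval (x + y) = η.eval x + η.eval y

/-- The iterated difference `∂_{u₁, …, u_m} f = ∂_{u_m} (⋯ (∂_{u₁} f))` along the list
`[u₁, …, u_m]`, where `∂_u f x = f (x + u) - f x`. -/
def iterDiff {K : Type*} [Field K] (us : List K) (f : K → K) : K → K :=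
  us.foldl (fun g u => fwdDiff u g) f

/-- The least `m ≥ 0` such that `∂_{u₁, …, u_{m+1}} P (y) = 0` for all `u₁, …, u_{m+1}, y ∈ K`. -/
noncomputable def derivationalDegree {K : Type*} [Field K] (P : K[X]) : ℕ :=
  sInf {m : ℕ | ∀ us : List K, us.length = m + 1 →
    ∀ y : K, iterDiff us (fun x => P.eval x) y = 0}

/-! The field `F((t⁻¹))` and its subring `F[t]`. Here `F[X]` is the ring `F[t]`. -/

open Classical in
/-- The field `F((t⁻¹))`, the completion of `F(t)` at the place at infinity. -/
noncomputable abbrev LaurentInf (F : Type*) [Field F] : Type _ := RatFunc.CompletionAtInfty F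

/-- The embedding of `F[t]` into `F((t⁻¹))`, through `F(t)`. -/
noncomputable def toLaurentInf (F : Type*) [Field F] : F[X] →+* LaurentInf F :=
  (algebraMap (RatFunc F) (LaurentInf F)).comp (algebraMap F[X] (RatFunc F))

/-! The rings `F[t]_Q`. -/

/-- The quotient ring `F[t]_Q = F[t] / Q F[t]`. -/
abbrev QuotRing {F : Type*} [Field F] (Q : F[X]) : Type _ := F[X] ⧸ Ideal.span {Q}

/-- For monic `Q` the ring `F[t]_Q` is finite, so averages over its subsets are genuine ones. -/
theorem finite_quotRing {F : Type*} [Field F] [Finite F] {Q : F[X]} (hQ : Q.Monic) :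
    Finite (QuotRing Q) :=
  have : Module.Finite F (QuotRing Q) := hQ.finite_quotient
  Module.finite_of_finite F

/-- Reduction mod `Q`. -/
noncomputable abbrev modQ {F : Type*} [Field F] (Q : F[X]) : F[X] →+* QuotRing Q :=
  Ideal.Quotient.mk (Ideal.span {Q})

/-- The absolute value on `F[t]`: `|m| = |F| ^ deg m` for `m ≠ 0`, and `|0| = 0`. -/
noncomputable def polyAbs {F : Type*} [Field F] (m : F[X]) : ℕ :=
  open Classical in if m = 0 then 0 else Nat.card F ^ m.natDegree

/-- `lpf Q`: the least absolute value of a monic irreducible factor of `Q`. For `Q = 1` there is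
no such factor; the value is then `0`, so that `c / lpf Q = 0` in `ℝ`, as for the convention
`min ∅ = ∞`. -/
noncomputable def lpf {F : Type*} [Field F] (Q : F[X]) : ℕ :=
  sInf {m : ℕ | ∃ R : F[X], R.Monic ∧ Irreducible R ∧ R ∣ Q ∧ polyAbs R = m}

/-- The set `H = ∑ i, η i (F[t])`, the sum of the images of `F[t]` under the `η i`. -/
def imageSum {F : Type*} [Field F] {n : ℕ} (η : Fin n → F[X][X]) : Set F[X] :=
  {z | ∃ y : Fin n → F[X], z = ∑ i, (η i).eval (y i)}

end PolyWeyl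

/-!
Both averages are convolution operators on the finite group `F[t]_Q`, so they are diagonalised by
its additive characters `χ` (`lrNorm_two_le_of_multiplier`), and it suffices to bound each
eigenvalue `𝔼_y χ (P y) - 𝔼_z χ (a₀ + z)`. If every `χ ∘ η i` is trivial, both terms equal `χ a₀`.
Otherwise the second term vanishes, and the first is, up to a unimodular factor, the average of
`∏ i, χᵢ (y ^ r i)` over those `i` for which `χᵢ = χ ∘ η i` is nontrivial
(`norm_expect_sub_expect_le`).

Let `m + 1` be the largest base-`p` digit sum of these `r i`. By Kummer's theorem each difference
lowers the digit sum of an exponent by at least one. Hence after `m` differences `y ^ r` becomes a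
constant plus `∑ j, N j (u) * y ^ p ^ j`, where the coefficients `N j` (`diffCoeff`) are homogeneous
polynomials in the increments `u`, each exponent of which is a power of `p`. Weyl differencing
(`norm_expect_prod_pow_le`) bounds the `2 ^ m`-th power of the average by the proportion of `u` for
which the additive character `y ↦ ∏ i, ∏ j, χᵢ (N i j (u) * y ^ p ^ j)` is trivial.

To bound this proportion for an arbitrary `Q`, let `R * T`, with `R` irreducible, generate the joint
annihilator of the `χᵢ` in `F[t]`. Substituting `T * y` for `y` turns the `χᵢ` into characters of the
field `F[t] / R`, not all trivial (`exists_characters_of_residueField`). In a finite field of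
characteristic `p`, duality and the inverse of Frobenius turn triviality of the character into an
algebraic equation for `u` (`exists_relation_of_primitive`, `degeneracyPoly`). The equation is
nontrivial because its terms have different degrees: the `r i` are distinct and prime to `p`, and
the coefficient of `y` in the differences of `y ^ r` is nonzero when `p ∤ r`. Its degree in each of
the `m` variables is at most `p ^ (2 * ⌊log_p d⌋)`, and the Schwartz–Zippel lemma bounds the
proportion of its solutions by `m * p ^ (2 * ⌊log_p d⌋) / |R|` (`card_degenerate_le`).

Finally `m + 1 ≤ k` and `r i ≤ d` for the `i` considered, since the monomials of the summands
`η i (y ^ r i)` cannot cancel and the digit sum of an exponent of `P` is at most the derivational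
degree (`digitSum_le_and_le_natDegree`).
-/

namespace PolyWeyl

/-! ### Digit sums in base `p` -/

/-- The sum of the digits of `n` in base `p`. It equals the derivational degree of `y ^ n` in
characteristic `p`. -/
def digitSum (p n : ℕ) : ℕ := (Nat.digits p n).sum

@[simp] lemma digitSum_zero (p : ℕ) : digitSum p 0 = 0 := by simp [digitSum]

lemma digitSum_mul_add {p : ℕ} (hp : 1 < p) (m : ℕ) {a : ℕ} (ha : a < p) :
    digitSum p (p * m + a) = digitSum p m + a := by
  rcases Nat.eq_zero_or_pos (p * m + a) with h | h
  · have h1 : a = 0 := by omega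
    have h2 : m = 0 := by
      rcases Nat.mul_eq_zero.mp (by omega : p * m = 0) with h3 | h3 <;> omega
    subst h1 h2; simp
  · unfold digitSum
    rw [Nat.digits_def' hp h]
    have h1 : (p * m + a) % p = a := by rw [Nat.mul_add_mod, Nat.mod_eq_of_lt ha]
    have h2 : (p * m + a) / p = m := by
      rw [Nat.mul_add_div (by omega), Nat.div_eq_of_lt ha, add_zero]
    rw [h1, h2, List.sum_cons, add_comm]

lemma digitSum_of_lt {p : ℕ} (hp : 1 < p) {a : ℕ} (ha : a < p) : digitSum p a = a := by
  simpa using digitSum_mul_add hp 0 ha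

lemma digitSum_mul_pow {p : ℕ} (hp : 1 < p) (m j : ℕ) :
    digitSum p (m * p ^ j) = digitSum p m := by
  induction j with
  | zero => simp
  | succ j ih =>
    rw [← ih, pow_succ, ← mul_assoc, mul_comm _ p]
    simpa using digitSum_mul_add hp (m * p ^ j) (a := 0) (by omega)

lemma digitSum_pow {p : ℕ} (hp : 1 < p) (j : ℕ) : digitSum p (p ^ j) = 1 := by
  have := digitSum_mul_pow hp 1 j
  rwa [one_mul, digitSum_of_lt hp hp] at this

lemma digitSum_pos {p : ℕ} (hp : 1 < p) {n : ℕ} (hn : 0 < n) : 0 < digitSum p n := by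
  induction n using Nat.strong_induction_on with
  | _ n ih =>
    have h := Nat.div_add_mod n p
    rw [← h, digitSum_mul_add hp _ (Nat.mod_lt _ (by omega))]
    rcases Nat.eq_zero_or_pos (n % p) with h0 | h0
    · have h1 : 0 < n / p := by
        rcases Nat.eq_zero_or_pos (n / p) with h2 | h2
        · rw [h2, h0] at h; omega
        · exact h2
      have := ih (n / p) (Nat.div_lt_self hn hp) h1
      omega
    · omega

lemma eq_pow_of_digitSum_eq_one {p : ℕ} (hp : 1 < p) {n : ℕ} (h : digitSum p n = 1) :
    ∃ j, n = p ^ j := by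
  induction n using Nat.strong_induction_on with
  | _ n ih =>
    have hn : 0 < n := by
      rcases Nat.eq_zero_or_pos n with h0 | h0
      · subst h0; simp at h
      · exact h0
    have hd := Nat.div_add_mod n p
    have hs := digitSum_mul_add hp (n / p) (Nat.mod_lt n (by omega : p > 0))
    rw [hd, h] at hs
    rcases Nat.eq_zero_or_pos (n / p) with h0 | h0
    · rw [h0] at hd hs
      simp only [digitSum_zero] at hs
      exact ⟨0, by simp; omega⟩
    · have h1 := digitSum_pos hp h0
      obtain ⟨j, hj⟩ := ih (n / p) (Nat.div_lt_self hn hp) (by omega)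
      refine ⟨j + 1, ?_⟩
      rw [hj] at hd
      rw [pow_succ, mul_comm]; omega

/-- Subtracting the leading power of `p` lowers the digit sum by one. -/
lemma digitSum_sub_pow_log {p : ℕ} (hp : 1 < p) {n : ℕ} (hn : 0 < n) :
    digitSum p (n - p ^ Nat.log p n) + 1 = digitSum p n := by
  induction n using Nat.strong_induction_on with
  | _ n ih =>
    by_cases hlt : n < p
    · rw [Nat.log_of_lt hlt, pow_zero, digitSum_of_lt hp hlt, digitSum_of_lt hp (by omega)]
      omega
    · push Not at hlt
      have h1 : 0 < n / p := Nat.div_pos hlt (by omega)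
      have h2 := ih (n / p) (Nat.div_lt_self hn hp) h1
      have h3 : p ^ Nat.log p (n / p) ≤ n / p := Nat.pow_log_le_self p h1.ne'
      have hd := Nat.div_add_mod n p
      have h4 : n - p ^ Nat.log p n = p * (n / p - p ^ Nat.log p (n / p)) + n % p := by
        rw [Nat.log_of_one_lt_of_le hp hlt, pow_succ, Nat.mul_sub, mul_comm (p ^ _) p]
        have := Nat.mul_le_mul_left p h3
        omega
      have hm := Nat.mod_lt n (by omega : p > 0)
      have h5 := digitSum_mul_add hp (n / p) hm
      rw [hd] at h5
      rw [h4, digitSum_mul_add hp _ hm, h5]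
      omega

/-- A consequence of Kummer's theorem: the binomial coefficient is a unit mod `p` only if no carry
occurs, that is only if digit sums add up. -/
lemma digitSum_add_le_of_not_dvd_choose {p : ℕ} (hp : p.Prime) {n k : ℕ} (hk : k ≤ n)
    (h : ¬ p ∣ n.choose k) : digitSum p k + digitSum p (n - k) ≤ digitSum p n := by
  have : Fact p.Prime := ⟨hp⟩
  have h1 := sub_one_mul_padicValNat_choose_eq_sub_sum_digits (p := p) hk
  rw [padicValNat.eq_zero_of_not_dvd h, mul_zero] at h1
  unfold digitSum
  omega

lemma not_dvd_choose_sub_pow_log {p : ℕ} (hp : p.Prime) {n : ℕ} (hn : 0 < n) :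
    ¬ p ∣ n.choose (n - p ^ Nat.log p n) := by
  have : Fact p.Prime := ⟨hp⟩
  have hle := Nat.pow_log_le_self p hn.ne'
  have h1 := sub_one_mul_padicValNat_choose_eq_sub_sum_digits (p := p)
    (Nat.sub_le n (p ^ Nat.log p n))
  have h2 := digitSum_sub_pow_log hp.one_lt hn
  have h3 := digitSum_pow hp.one_lt (Nat.log p n)
  rw [Nat.sub_sub_self hle] at h1
  unfold digitSum at h2 h3
  rw [h3, h2, Nat.sub_self, Nat.mul_eq_zero] at h1
  have h4 : padicValNat p (n.choose (n - p ^ Nat.log p n)) = 0 := by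
    have := hp.one_lt
    omega
  intro hdvd
  rcases padicValNat.eq_zero_iff.mp h4 with h | h | h
  · exact hp.one_lt.ne' h
  · exact (Nat.choose_pos (Nat.sub_le _ _)).ne' h
  · exact h hdvd

lemma not_dvd_sub_pow_log {p : ℕ} (hp : p.Prime) {n : ℕ} (hn : ¬ p ∣ n) (hn1 : n ≠ 1) :
    ¬ p ∣ n - p ^ Nat.log p n := by
  have h0 : n ≠ 0 := by rintro rfl; simp at hn
  have hle := Nat.pow_log_le_self p h0
  rcases Nat.eq_zero_or_pos (Nat.log p n) with h | h
  · rw [h, pow_zero]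
    have : n < p := by
      rcases Nat.log_eq_zero_iff.mp h with h | h
      · exact h
      · have := hp.one_lt; omega
    exact Nat.not_dvd_of_pos_of_lt (by omega) (by omega)
  · intro hd
    exact hn ((Nat.dvd_sub_iff_left hle (dvd_pow_self p h.ne')).mp hd)

/-! ### Iterated differences of powers -/

/-- The iterated difference `∂_{u₀, …, u_{m-1}} g` along a finite family of increments. -/
def iterFwdDiff {A B : Type*} [AddCommMonoid A] [AddCommGroup B] :
    (m : ℕ) → (Fin m → A) → (A → B) → A → B
  | 0, _, g => g
  | m + 1, u, g => iterFwdDiff m (Fin.tail u) (fwdDiff (u 0) g)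

section iterFwdDiff

variable {A B C : Type*} [AddCommMonoid A] [AddCommGroup B] [AddCommGroup C]

lemma iterFwdDiff_comp_addMonoidHom (φ : B →+ C) (m : ℕ) (u : Fin m → A) (g : A → B) :
    iterFwdDiff m u (fun y => φ (g y)) = fun y => φ (iterFwdDiff m u g y) := by
  induction m generalizing g with
  | zero => rfl
  | succ m ih =>
    have h : fwdDiff (u 0) (fun y => φ (g y)) = fun y => φ (fwdDiff (u 0) g y) := by
      funext y; simp [fwdDiff]
    simp only [iterFwdDiff]
    rw [h, ih]

lemma iterFwdDiff_finset_sum {ι : Type*} (S : Finset ι) (m : ℕ) (u : Fin m → A)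
    (g : ι → A → B) :
    iterFwdDiff m u (fun y => ∑ s ∈ S, g s y) =
      fun y => ∑ s ∈ S, iterFwdDiff m u (g s) y := by
  induction m generalizing g with
  | zero => rfl
  | succ m ih =>
    have h : fwdDiff (u 0) (fun y => ∑ s ∈ S, g s y) = fun y => ∑ s ∈ S, fwdDiff (u 0) (g s) y := by
      funext y; simp [fwdDiff]
    simp only [iterFwdDiff]
    rw [h, ih]

end iterFwdDiff

lemma iterDiff_ofFn {K : Type*} [Field K] (m : ℕ) (u : Fin m → K) (g : K → K) :
    iterDiff (List.ofFn u) g = iterFwdDiff m u g := by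
  induction m generalizing g with
  | zero => simp [iterDiff, iterFwdDiff]
  | succ m ih =>
    rw [List.ofFn_succ, iterFwdDiff, ← ih]
    rfl

/-- The coefficient of `y ^ l` in the iterated difference `∂_{u₀, …, u_{m-1}} y ^ r`. It is a
universal polynomial in the increments, which is recovered by taking them to be variables. -/
def diffCoeff {A : Type*} [CommRing A] : (m : ℕ) → (Fin m → A) → ℕ → ℕ → A
  | 0, _, l, r => if l = r then 1 else 0
  | m + 1, u, l, r =>
    ∑ s ∈ Finset.range r, (r.choose s : A) * u 0 ^ (r - s) * diffCoeff m (Fin.tail u) l s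

section diffCoeff

variable {A : Type*} [CommRing A]

lemma map_diffCoeff {B : Type*} [CommRing B] (φ : A →+* B) (m : ℕ) (u : Fin m → A) (l r : ℕ) :
    φ (diffCoeff m u l r) = diffCoeff m (fun i => φ (u i)) l r := by
  induction m generalizing r with
  | zero => simp only [diffCoeff]; split_ifs <;> simp
  | succ m ih =>
    simp only [diffCoeff, map_sum, map_mul, map_natCast, map_pow, ih]
    rfl

lemma iterFwdDiff_pow {N r : ℕ} (hr : r < N) (m : ℕ) (u : Fin m → A) (y : A) :
    iterFwdDiff m u (fun y => y ^ r) y = ∑ l ∈ Finset.range N, diffCoeff m u l r * y ^ l := by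
  induction m generalizing r with
  | zero => simp [iterFwdDiff, diffCoeff, hr]
  | succ m ih =>
    have h : fwdDiff (u 0) (fun y => y ^ r) = fun y => ∑ s ∈ Finset.range r,
        AddMonoidHom.mulLeft ((r.choose s : A) * u 0 ^ (r - s)) (y ^ s) := by
      funext y
      simp only [fwdDiff, add_pow, Finset.sum_range_succ, AddMonoidHom.coe_mulLeft]
      simp only [Nat.sub_self, pow_zero, Nat.choose_self, Nat.cast_one, mul_one, add_sub_cancel_right]
      exact Finset.sum_congr rfl fun s _ => by ring
    rw [iterFwdDiff, h, iterFwdDiff_finset_sum]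
    simp only [iterFwdDiff_comp_addMonoidHom, diffCoeff, Finset.sum_mul]
    rw [Finset.sum_comm]
    refine Finset.sum_congr rfl fun s hs => ?_
    rw [ih ((Finset.mem_range.mp hs).trans hr), map_sum]
    exact Finset.sum_congr rfl fun l _ => by simp [mul_assoc]

/-- Each difference removes at least one unit from the digit sum, because a binomial coefficient
`r.choose s` with `s < r` is a multiple of `p` unless the digit sum of `s` is less than that
of `r`. -/
lemma diffCoeff_eq_zero {p : ℕ} (hp : p.Prime) (hpA : (p : A) = 0) (m : ℕ) (u : Fin m → A)
    {l r : ℕ} (h : digitSum p r < digitSum p l + m) : diffCoeff m u l r = 0 := by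
  induction m generalizing r with
  | zero =>
    simp only [diffCoeff]
    rw [if_neg]
    rintro rfl
    omega
  | succ m ih =>
    simp only [diffCoeff]
    refine Finset.sum_eq_zero fun s hs => ?_
    rw [Finset.mem_range] at hs
    by_cases hd : p ∣ r.choose s
    · obtain ⟨c, hc⟩ := hd
      simp [hc, hpA]
    · have h1 := digitSum_add_le_of_not_dvd_choose hp hs.le hd
      have h2 := digitSum_pos hp.one_lt (Nat.sub_pos_of_lt hs)
      rw [ih _ (by omega), mul_zero]

/-- Once all but one unit of the digit sum is used up, the difference of a power is an affine
additive polynomial. -/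
lemma iterFwdDiff_pow_eq_additive {p : ℕ} (hp : p.Prime) (hpA : (p : A) = 0) (m : ℕ)
    (u : Fin m → A) {r J : ℕ} (hm : digitSum p r ≤ m + 1) (hr : r < p ^ (J + 1)) (y : A) :
    iterFwdDiff m u (fun y => y ^ r) y =
      diffCoeff m u 0 r + ∑ j ∈ Finset.range (J + 1), diffCoeff m u (p ^ j) r * y ^ p ^ j := by
  rw [iterFwdDiff_pow hr]
  have hinj : Function.Injective fun j => p ^ j := Nat.pow_right_injective hp.two_le
  have hsub : insert 0 ((Finset.range (J + 1)).image fun j => p ^ j) ⊆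
      Finset.range (p ^ (J + 1)) := by
    intro l hl
    simp only [Finset.mem_insert, Finset.mem_image, Finset.mem_range] at hl ⊢
    rcases hl with rfl | ⟨j, hj, rfl⟩
    · exact pow_pos hp.pos _
    · exact Nat.pow_lt_pow_right hp.one_lt hj
  rw [← Finset.sum_subset hsub, Finset.sum_insert, Finset.sum_image (fun _ _ _ _ h => hinj h),
    pow_zero, mul_one]
  · simp [hp.ne_zero]
  · intro l hl hl'
    simp only [Finset.mem_insert, Finset.mem_image, Finset.mem_range, not_or, not_exists,
      not_and] at hl hl'
    rw [diffCoeff_eq_zero hp hpA, zero_mul]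
    have h0 := digitSum_pos hp.one_lt (Nat.pos_of_ne_zero hl'.1)
    have h1 : digitSum p l ≠ 1 := fun h1 => by
      obtain ⟨j, rfl⟩ := eq_pow_of_digitSum_eq_one hp.one_lt h1
      exact hl'.2 j ((Nat.pow_lt_pow_iff_right hp.one_lt).mp hl) rfl
    omega

lemma diffCoeff_eq_zero_of_lt (m : ℕ) (u : Fin m → A) {l r : ℕ} (h : r < l + m) :
    diffCoeff m u l r = 0 := by
  induction m generalizing r with
  | zero => simp [diffCoeff, (show r < l from h).ne']
  | succ m ih =>
    simp only [diffCoeff]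
    refine Finset.sum_eq_zero fun t ht => ?_
    have := Finset.mem_range.mp ht
    rw [ih _ (by omega), mul_zero]

lemma diffCoeff_mul (m : ℕ) (u : Fin m → A) (c : A) (l r : ℕ) :
    diffCoeff m (fun i => c * u i) l r = c ^ (r - l) * diffCoeff m u l r := by
  induction m generalizing r with
  | zero =>
    simp only [diffCoeff]
    split_ifs with h
    · simp [h]
    · simp
  | succ m ih =>
    simp only [diffCoeff, Finset.mul_sum]
    refine Finset.sum_congr rfl fun s hs => ?_
    rw [Finset.mem_range] at hs
    have : (Fin.tail fun i => c * u i) = fun i => c * Fin.tail u i := rfl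
    rw [this, ih]
    by_cases hl : l ≤ s
    · have : r - l = (r - s) + (s - l) := by omega
      rw [this, mul_pow, pow_add]; ring
    · rw [diffCoeff_eq_zero_of_lt m _ (by omega)]; simp

end diffCoeff

section generic

variable {K : Type*} [Field K]

/-- The coefficient of `y ^ l` in `∂_{X₀, …, X_{m-1}} y ^ r`, for variables `Xᵢ`. -/
noncomputable def genDiffCoeff (K : Type*) [Field K] (m l r : ℕ) : MvPolynomial (Fin m) K :=
  diffCoeff m MvPolynomial.X l r

lemma eval_genDiffCoeff (m l r : ℕ) (u : Fin m → K) :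
    MvPolynomial.eval u (genDiffCoeff K m l r) = diffCoeff m u l r := by
  rw [genDiffCoeff, map_diffCoeff]; simp

/-- The universal polynomials are homogeneous: replacing the variables `Xᵢ` by `T * Xᵢ` multiplies
them by a power of `T`. -/
lemma aeval_genDiffCoeff (m l r : ℕ) :
    MvPolynomial.aeval (fun i => X * Polynomial.C (MvPolynomial.X i)) (genDiffCoeff K m l r) =
      (X ^ (r - l) * Polynomial.C (genDiffCoeff K m l r) : (MvPolynomial (Fin m) K)[X]) := by
  let φ : MvPolynomial (Fin m) K →ₐ[K] (MvPolynomial (Fin m) K)[X] :=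
    MvPolynomial.aeval fun i => X * Polynomial.C (MvPolynomial.X i)
  have h1 := map_diffCoeff (φ : MvPolynomial (Fin m) K →+* (MvPolynomial (Fin m) K)[X]) m
    MvPolynomial.X l r
  have h2 : (fun i : Fin m => (φ : MvPolynomial (Fin m) K →+* (MvPolynomial (Fin m) K)[X])
      (MvPolynomial.X i)) = fun i => X * Polynomial.C (MvPolynomial.X i) := by
    funext i; simp [φ]
  rw [h2, diffCoeff_mul m (fun i => Polynomial.C (MvPolynomial.X i : MvPolynomial (Fin m) K)),
    ← map_diffCoeff] at h1
  exact h1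

/-- In the extremal case the universal polynomial does not vanish: peel off the leading powers
of `p` from `r` one by one. -/
lemma genDiffCoeff_ne_zero {p : ℕ} (hp : p.Prime) [CharP K p] {m l r : ℕ}
    (hl : l = 0 ∨ l = 1 ∧ ¬ p ∣ r) (h : digitSum p l + m = digitSum p r) :
    genDiffCoeff K m l r ≠ 0 := by
  -- It is enough to find increments in some polynomial ring where the value is nonzero.
  suffices H : ∃ (σ : Type) (u : Fin m → MvPolynomial σ K), diffCoeff m u l r ≠ 0 by
    obtain ⟨σ, u, hu⟩ := H
    intro h0
    apply hu
    have := map_diffCoeff (MvPolynomial.aeval u : MvPolynomial (Fin m) K →ₐ[K] _).toRingHom m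
      MvPolynomial.X l r
    simp only [AlgHom.toRingHom_eq_coe, RingHom.coe_coe, MvPolynomial.aeval_X] at this
    rw [← this]
    change MvPolynomial.aeval u (genDiffCoeff K m l r) = 0
    rw [h0, map_zero]
  induction m generalizing r with
  | zero =>
    refine ⟨Empty, Fin.elim0, ?_⟩
    have : l = r := by
      rcases hl with rfl | ⟨rfl, hr⟩
      · by_contra hne
        have := digitSum_pos hp.one_lt (Nat.pos_of_ne_zero (Ne.symm hne))
        simp at h; omega
      · rw [digitSum_of_lt hp.one_lt hp.one_lt] at h
        obtain ⟨j, rfl⟩ := eq_pow_of_digitSum_eq_one hp.one_lt (by omega : digitSum p r = 1)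
        rcases Nat.eq_zero_or_pos j with rfl | hj
        · simp
        · exact absurd (dvd_pow_self p hj.ne') hr
    simp [diffCoeff, this]
  | succ m ih =>
    have hr0 : 0 < r := by
      rcases Nat.eq_zero_or_pos r with rfl | h0
      · simp at h
      · exact h0
    set s := r - p ^ Nat.log p r with hs
    have hple := Nat.pow_log_le_self p hr0.ne'
    have hppos : 0 < p ^ Nat.log p r := pow_pos hp.pos _
    have hds : digitSum p s + 1 = digitSum p r := digitSum_sub_pow_log hp.one_lt hr0
    obtain ⟨σ, u, hu⟩ := ih (r := s) (by
      rcases hl with rfl | ⟨rfl, hr⟩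
      · exact Or.inl rfl
      · refine Or.inr ⟨rfl, not_dvd_sub_pow_log hp hr ?_⟩
        rintro rfl
        omega) (by omega)
    -- Adjoin one more variable and read off the coefficient of `X ^ (r - s)`.
    have key : diffCoeff (m + 1) (Fin.cons Polynomial.X fun i => Polynomial.C (u i)) l r ≠
        (0 : (MvPolynomial σ K)[X]) := by
      intro h0
      have h1 := congrArg (fun q => Polynomial.coeff q (r - s)) h0
      simp only [diffCoeff, Fin.cons_zero, Fin.tail_cons, Polynomial.coeff_zero,
        Polynomial.finsetSum_coeff] at h1
      rw [Finset.sum_eq_single s] at h1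
      · rw [← map_diffCoeff Polynomial.C, Polynomial.coeff_mul_C, ← Polynomial.C_eq_natCast,
          Polynomial.coeff_C_mul, Polynomial.coeff_X_pow_self, mul_one] at h1
        rcases mul_eq_zero.mp h1 with h2 | h2
        · rw [CharP.cast_eq_zero_iff (MvPolynomial σ K) p] at h2
          exact not_dvd_choose_sub_pow_log hp hr0 h2
        · exact hu h2
      · intro t ht hts
        rw [Finset.mem_range] at ht
        rw [← map_diffCoeff Polynomial.C, Polynomial.coeff_mul_C, ← Polynomial.C_eq_natCast,
          Polynomial.coeff_C_mul, Polynomial.coeff_X_pow, if_neg (by omega)]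
        simp
      · intro hns
        exact absurd (Finset.mem_range.mpr (by omega)) hns
    let e : MvPolynomial (Option σ) K ≃ₐ[K] (MvPolynomial σ K)[X] := MvPolynomial.optionEquivLeft K σ
    refine ⟨Option σ, fun i => e.symm (Fin.cons (α := fun _ => (MvPolynomial σ K)[X]) Polynomial.X
      (fun i => Polynomial.C (u i)) i), ?_⟩
    have := map_diffCoeff (e.symm : (MvPolynomial σ K)[X] →+* MvPolynomial (Option σ) K) (m + 1)
      (Fin.cons Polynomial.X fun i => Polynomial.C (u i)) l r
    simp only [RingHom.coe_coe] at this
    rw [← this]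
    simpa using key

/-- In the extremal case every exponent in the universal polynomial is `0` or a power of `p`: each
difference has to lower the digit sum by exactly one, so that `r - s` has digit sum one in each
contributing term of the recursion. -/
lemma degreeOf_genDiffCoeff_le {p : ℕ} (hp : p.Prime) [CharP K p] {m l r J : ℕ}
    (h : digitSum p r ≤ digitSum p l + m) (hr : r < p ^ (J + 1)) (i : Fin m) :
    (genDiffCoeff K m l r).degreeOf i ≤ p ^ J := by
  -- The induction passes to a tail of the family of increments, so they are taken to be any distinct
  -- variables; a variable that is not among them must be known not to occur.
  have key : ∀ (σ : Type) (i₀ : σ) (m : ℕ) (u : Fin m → σ) (r : ℕ), Function.Injective u →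
      digitSum p r ≤ digitSum p l + m → r < p ^ (J + 1) →
      (diffCoeff m (fun i => (MvPolynomial.X (u i) : MvPolynomial σ K)) l r).degreeOf i₀ ≤ p ^ J ∧
      (i₀ ∉ Set.range u →
      (diffCoeff m (fun i => (MvPolynomial.X (u i) : MvPolynomial σ K)) l r).degreeOf i₀ = 0) := by
    intro σ i₀ m
    induction m with
    | zero =>
      intro u r _ _ _
      simp only [diffCoeff]
      split_ifs <;> simp
    | succ m ih =>
      intro u r hu h hr
      have hterm : ∀ s ∈ Finset.range r, ((r.choose s : MvPolynomial σ K) *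
          MvPolynomial.X (u 0) ^ (r - s) * diffCoeff m
            (Fin.tail fun i => (MvPolynomial.X (u i) : MvPolynomial σ K)) l s).degreeOf i₀ ≤ p ^ J ∧
          (i₀ ∉ Set.range u → ((r.choose s : MvPolynomial σ K) *
          MvPolynomial.X (u 0) ^ (r - s) * diffCoeff m
            (Fin.tail fun i => (MvPolynomial.X (u i) : MvPolynomial σ K)) l s).degreeOf i₀ = 0) := by
        intro s hs
        rw [Finset.mem_range] at hs
        by_cases hd : p ∣ r.choose s
        · rw [(CharP.cast_eq_zero_iff (MvPolynomial σ K) p _).mpr hd]; simp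
        have h1 := digitSum_add_le_of_not_dvd_choose hp hs.le hd
        have h2 := digitSum_pos hp.one_lt (Nat.sub_pos_of_lt hs)
        have htail : (Fin.tail fun i => (MvPolynomial.X (u i) : MvPolynomial σ K)) =
          fun i => MvPolynomial.X (Fin.tail u i) := rfl
        rw [htail]
        by_cases hz : diffCoeff m
            (fun i => (MvPolynomial.X (Fin.tail u i) : MvPolynomial σ K)) l s = 0
        · rw [hz]; simp
        have hinj : Function.Injective (Fin.tail u) := hu.comp (Fin.succ_injective m)
        obtain ⟨ih1, ih2⟩ := ih (Fin.tail u) s hinj (by omega) (hs.trans hr)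
        have hc : (r.choose s : MvPolynomial σ K) = MvPolynomial.C (r.choose s : K) := by simp
        rw [mul_assoc, hc]
        have hle := (MvPolynomial.degreeOf_C_mul_le (MvPolynomial.X (u 0) ^ (r - s) * diffCoeff m
          (fun i => (MvPolynomial.X (Fin.tail u i) : MvPolynomial σ K)) l s) i₀
          (r.choose s : K)).trans (MvPolynomial.degreeOf_mul_le i₀ _ _)
        by_cases hi : i₀ = u 0
        · have hnot : i₀ ∉ Set.range (Fin.tail u) := by
            rintro ⟨j, hj⟩
            rw [hi] at hj
            exact (Fin.succ_ne_zero j) (hu hj)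
          rw [ih2 hnot, add_zero, hi, MvPolynomial.degreeOf_X_self_pow] at hle
          refine ⟨?_, fun hn => absurd ⟨0, hi.symm⟩ hn⟩
          rw [hi]
          refine hle.trans ?_
          have h3 : digitSum p l + m ≤ digitSum p s := by
            by_contra hlt
            exact hz (diffCoeff_eq_zero hp (by simp) m _ (by omega))
          obtain ⟨j, hj⟩ := eq_pow_of_digitSum_eq_one hp.one_lt
            (by omega : digitSum p (r - s) = 1)
          rw [hj]
          refine Nat.pow_le_pow_right hp.pos (Nat.lt_succ_iff.mp ?_)
          refine (Nat.pow_lt_pow_iff_right hp.one_lt).mp (?_ : p ^ j < p ^ (J + 1))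
          omega
        · rw [MvPolynomial.degreeOf_X_pow_of_ne _ hi, zero_add] at hle
          refine ⟨hle.trans ih1, fun hn => Nat.le_zero.mp (hle.trans (ih2 ?_).le)⟩
          rintro ⟨j, hj⟩
          exact hn ⟨j.succ, hj⟩
      simp only [diffCoeff]
      refine ⟨(MvPolynomial.degreeOf_sum_le _ _ _).trans (Finset.sup_le fun s hs => (hterm s hs).1),
        fun hn => Nat.le_zero.mp ((MvPolynomial.degreeOf_sum_le _ _ _).trans
          (Finset.sup_le fun s hs => ((hterm s hs).2 hn).le))⟩
  exact (key (Fin m) i m id r Function.injective_id h hr).1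

end generic

/-! ### Counting degenerate increments in a finite field -/

lemma addChar_sum {A ι : Type*} [AddCommMonoid A] (ψ : AddChar A ℂ) (S : Finset ι) (g : ι → A) :
    ψ (∑ i ∈ S, g i) = ∏ i ∈ S, ψ (g i) := by
  classical
  induction S using Finset.induction_on with
  | empty => simp
  | insert a S ha ih => rw [Finset.sum_insert ha, Finset.prod_insert ha, ψ.map_add_eq_mul, ih]

section finiteField

variable {K : Type*} [Field K] {p : ℕ} [CharP K p] {ι : Type*}

/-- A polynomial in the increments `u` that vanishes whenever the additive polynomial
`∑ j, c j * (∑ i ∈ I, b i * diffCoeff m u (p ^ j) (r i)) * y ^ p ^ j` takes all its values in the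
kernel of a primitive character `ψ`. The weights `w` are `p ^ J`-th powers of the constants that
describe how Frobenius acts on `ψ`, see `exists_relation_of_primitive`. -/
noncomputable def degeneracyPoly (p m J : ℕ) (I : Finset ι) (r : ι → ℕ) (b : ι → K)
    (c w : ℕ → K) : MvPolynomial (Fin m) K :=
  ∑ j ∈ Finset.range (J + 1), MvPolynomial.C (w j) *
    (MvPolynomial.C (c j) *
      ∑ i ∈ I, MvPolynomial.C (b i) * genDiffCoeff K m (p ^ j) (r i)) ^ p ^ (J - j)

/-- Replacing the variables `Xᵢ` by `T * Xᵢ` separates the terms of `degeneracyPoly`: the one with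
index `(i, j)` is homogeneous of degree `(r i - p ^ j) * p ^ (J - j)`, and these degrees determine
`i` and `j`, as the `r i` are distinct and prime to `p`. -/
lemma degeneracyPoly_ne_zero (hp : p.Prime) {m J : ℕ} {I : Finset ι} {r : ι → ℕ} {b : ι → K}
    {c w : ℕ → K} (hr : ∀ i ∈ I, ¬ p ∣ r i) (hinj : Function.Injective r)
    (hs : ∀ i ∈ I, digitSum p (r i) = m + 1) {i₀ : ι} (hi₀ : i₀ ∈ I) (hb : b i₀ ≠ 0)
    (hc : c 0 ≠ 0) (hw : w 0 ≠ 0) : degeneracyPoly p m J I r b c w ≠ 0 := by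
  have : Fact p.Prime := ⟨hp⟩
  intro h0
  let φ : MvPolynomial (Fin m) K →ₐ[K] (MvPolynomial (Fin m) K)[X] :=
    MvPolynomial.aeval fun i => X * Polynomial.C (MvPolynomial.X i)
  have hφ : ∀ l s, φ (genDiffCoeff K m l s) = X ^ (s - l) * Polynomial.C (genDiffCoeff K m l s) :=
    fun l s => aeval_genDiffCoeff m l s
  have hC : ∀ a : K, φ (MvPolynomial.C a) = Polynomial.C (MvPolynomial.C a) := by
    intro a
    rw [← MvPolynomial.algebraMap_eq, AlgHom.commutes]; rfl
  have h1 : φ (degeneracyPoly p m J I r b c w) = ∑ j ∈ Finset.range (J + 1), ∑ i ∈ I,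
      Polynomial.C (MvPolynomial.C (w j) * (MvPolynomial.C (c j) * (MvPolynomial.C (b i) *
        genDiffCoeff K m (p ^ j) (r i))) ^ p ^ (J - j)) *
      X ^ ((r i - p ^ j) * p ^ (J - j)) := by
    rw [degeneracyPoly, map_sum]
    refine Finset.sum_congr rfl fun j _ => ?_
    rw [map_mul, map_pow, map_mul, map_sum, Finset.mul_sum, sum_pow_char_pow, Finset.mul_sum]
    refine Finset.sum_congr rfl fun i _ => ?_
    simp only [map_mul, hC, hφ, map_pow]
    rw [pow_mul]
    ring
  have h2 := congrArg (fun q => Polynomial.coeff q ((r i₀ - 1) * p ^ J)) h1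
  simp only [h0, map_zero, Polynomial.coeff_zero, Polynomial.finsetSum_coeff,
    Polynomial.coeff_C_mul, Polynomial.coeff_X_pow] at h2
  have hpos : ∀ i ∈ I, 0 < r i := fun i hi =>
    Nat.pos_of_ne_zero fun h => hr i hi (h ▸ dvd_zero p)
  rw [Finset.sum_eq_single 0, Finset.sum_eq_single i₀] at h2
  · have hg := genDiffCoeff_ne_zero (K := K) hp (m := m) (l := 1) (r := r i₀)
      (Or.inr ⟨rfl, hr i₀ hi₀⟩) (by rw [digitSum_of_lt hp.one_lt hp.one_lt, hs i₀ hi₀, add_comm])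
    simp [hw, hc, hb, hg, hp.ne_zero] at h2
  · intro i hi hne
    rw [if_neg, mul_zero]
    intro h
    simp only [pow_zero, Nat.sub_zero] at h
    have h3 := Nat.eq_of_mul_eq_mul_right (pow_pos hp.pos J) h
    have h4 := hpos i hi
    have h5 := hpos i₀ hi₀
    exact hne (hinj (by omega))
  · exact fun h => absurd hi₀ h
  · -- Equality of the degrees would give `r i = r i₀ * p ^ j`, against `¬ p ∣ r i`.
    intro j hj hj0
    refine Finset.sum_eq_zero fun i hi => ?_
    rcases Nat.lt_or_ge (r i) (p ^ j) with hlt | hge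
    · rw [genDiffCoeff, diffCoeff_eq_zero_of_lt m _ (by omega)]
      simp [hp.ne_zero]
    · rw [if_neg, mul_zero]
      intro h
      have hjJ : j ≤ J := Nat.lt_succ_iff.mp (Finset.mem_range.mp hj)
      have hJ : p ^ J = p ^ j * p ^ (J - j) := by rw [← pow_add]; congr 1; omega
      have hpp : 0 < p ^ (J - j) := pow_pos hp.pos _
      rw [hJ, ← mul_assoc] at h
      have h3 := Nat.eq_of_mul_eq_mul_right hpp h
      have h5 := hpos i₀ hi₀
      have h6 : r i = r i₀ * p ^ j := by
        rw [Nat.sub_mul, one_mul] at h3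
        have : p ^ j ≤ r i₀ * p ^ j := Nat.le_mul_of_pos_left _ h5
        omega
      exact hr i hi (h6 ▸ Dvd.dvd.mul_left (dvd_pow_self p hj0) _)
  · intro h; simp at h

lemma degreeOf_degeneracyPoly_le (hp : p.Prime) {m J : ℕ} {I : Finset ι} {r : ι → ℕ} {b : ι → K}
    {c w : ℕ → K} (hs : ∀ i ∈ I, digitSum p (r i) = m + 1) (hJ : ∀ i ∈ I, r i < p ^ (J + 1))
    (t : Fin m) : (degeneracyPoly p m J I r b c w).degreeOf t ≤ p ^ (2 * J) := by
  refine (MvPolynomial.degreeOf_sum_le _ _ _).trans (Finset.sup_le fun j _ => ?_)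
  refine (MvPolynomial.degreeOf_C_mul_le _ _ _).trans ?_
  refine (MvPolynomial.degreeOf_pow_le _ _ _).trans ?_
  have h1 : (MvPolynomial.C (c j) *
      ∑ i ∈ I, MvPolynomial.C (b i) * genDiffCoeff K m (p ^ j) (r i)).degreeOf t ≤ p ^ J := by
    refine (MvPolynomial.degreeOf_C_mul_le _ _ _).trans ?_
    refine (MvPolynomial.degreeOf_sum_le _ _ _).trans (Finset.sup_le fun i hi => ?_)
    refine (MvPolynomial.degreeOf_C_mul_le _ _ _).trans ?_
    refine degreeOf_genDiffCoeff_le hp ?_ (hJ i hi) t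
    rw [hs i hi, digitSum_pow hp.one_lt, add_comm]
  calc _ ≤ p ^ (J - j) * p ^ J := Nat.mul_le_mul_left _ h1
    _ ≤ p ^ J * p ^ J := Nat.mul_le_mul_right _ (Nat.pow_le_pow_right hp.pos (Nat.sub_le _ _))
    _ = p ^ (2 * J) := by rw [← pow_add, two_mul]

lemma mulShift_surjective [Finite K] {ψ : AddChar K ℂ} (hψ : ψ.IsPrimitive) :
    Function.Surjective ψ.mulShift := by
  have : Fintype K := Fintype.ofFinite K
  exact ((Fintype.bijective_iff_injective_and_card _).mpr
    ⟨AddChar.to_mulShift_inj_of_isPrimitive hψ, AddChar.card_eq.symm⟩).2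

/-- If `∑ⱼ aⱼ y ^ (p ^ j)` lies in the kernel of a primitive character for all `y`, then the `aⱼ`
satisfy an algebraic relation: by duality `ψ (y ^ p ^ j) = ψ (wⱼ y)` for some `wⱼ`, and the
`p ^ j`-th root of `aⱼ` can be pulled out of the Frobenius power. -/
lemma exists_relation_of_primitive [Finite K] (hp : p.Prime) {ψ : AddChar K ℂ} (hψ : ψ.IsPrimitive) :
    ∃ w : ℕ → K, w 0 = 1 ∧ ∀ (J : ℕ) (a : ℕ → K),
      (∀ y, ψ (∑ j ∈ Finset.range (J + 1), a j * y ^ p ^ j) = 1) →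
        ∑ j ∈ Finset.range (J + 1), w j ^ p ^ J * a j ^ p ^ (J - j) = 0 := by
  have : Fact p.Prime := ⟨hp⟩
  have hdual : ∀ j : ℕ, ∃ w : K, ∀ y, ψ (y ^ p ^ j) = ψ (w * y) := by
    intro j
    obtain ⟨w, hw⟩ := mulShift_surjective hψ
      (ψ.compAddMonoidHom (iterateFrobenius K p j).toAddMonoidHom)
    exact ⟨w, fun y => (DFunLike.congr_fun hw y).symm⟩
  obtain ⟨v, hv0, hw'⟩ : ∃ v : ℕ → K, v 0 = 1 ∧ ∀ j y, ψ (y ^ p ^ j) = ψ (v j * y) := by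
    choose w hw using hdual
    refine ⟨fun j => if j = 0 then 1 else w j, by simp, fun j y => ?_⟩
    dsimp only
    split_ifs with hj
    · simp [hj]
    · exact hw j y
  refine ⟨v, hv0, fun J a h => ?_⟩
  choose a' ha' using fun j => (bijective_iterateFrobenius K p j).2 (a j)
  simp only [iterateFrobenius_def] at ha'
  have h0 : ∑ j ∈ Finset.range (J + 1), v j * a' j = 0 := by
    by_contra hne
    refine hψ hne (DFunLike.ext _ _ fun y => ?_)
    rw [AddChar.mulShift_apply, AddChar.one_apply, ← h y, Finset.sum_mul,
      addChar_sum, addChar_sum]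
    refine Finset.prod_congr rfl fun j _ => ?_
    rw [← ha' j, ← mul_pow, hw', mul_assoc]
  have h1 := congrArg (fun z => z ^ p ^ J) h0
  simp only [sum_pow_char_pow, mul_pow] at h1
  rw [zero_pow (pow_pos hp.pos J).ne'] at h1
  rw [← h1]
  refine Finset.sum_congr rfl fun j hj => ?_
  rw [← ha' j, ← pow_mul, ← pow_add]
  congr 3
  have := Finset.mem_range.mp hj
  omega

/-- Increments at which a product of twisted Frobenius characters is trivial are zeros of a nonzero
polynomial of degree at most `p ^ (2 * J)` in each of the `m` variables, so that the
Schwartz–Zippel lemma bounds their proportion. -/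
lemma card_degenerate_le [Fintype K] [DecidableEq K] (hp : p.Prime) {m J : ℕ} {I : Finset ι}
    {r : ι → ℕ} (hr : ∀ i ∈ I, ¬ p ∣ r i) (hinj : Function.Injective r)
    (hs : ∀ i ∈ I, digitSum p (r i) = m + 1) (hJ : ∀ i ∈ I, r i < p ^ (J + 1))
    (τ : ι → AddChar K ℂ) {i₀ : ι} (hi₀ : i₀ ∈ I) (hτ : τ i₀ ≠ 1) {c : ℕ → K} (hc : c 0 ≠ 0)
    (Z : Finset (Fin m → K))
    (hZ : ∀ u ∈ Z, ∀ y, ∏ i ∈ I, ∏ j ∈ Finset.range (J + 1),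
      τ i (c j * diffCoeff m u (p ^ j) (r i) * y ^ p ^ j) = 1) :
    (Z.card : ℝ) / Fintype.card K ^ m ≤ m * p ^ (2 * J) / Fintype.card K := by
  have hψ : (τ i₀).IsPrimitive := AddChar.IsPrimitive.of_ne_one hτ
  choose b hb using fun i => mulShift_surjective hψ (τ i)
  have hb₀ : b i₀ ≠ 0 := by
    intro h
    have := hb i₀
    rw [h, AddChar.mulShift_zero] at this
    exact hτ this.symm
  obtain ⟨w, hw0, hw⟩ := exists_relation_of_primitive hp hψ
  set G := degeneracyPoly p m J I r b c (fun j => w j ^ p ^ J) with hG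
  have hG0 : G ≠ 0 := degeneracyPoly_ne_zero hp hr hinj hs hi₀ hb₀ hc (by simp [hw0])
  have hzero : ∀ u ∈ Z, MvPolynomial.eval u G = 0 := by
    intro u hu
    have h1 := hw J (fun j => c j * ∑ i ∈ I, b i * diffCoeff m u (p ^ j) (r i)) fun y => by
      rw [← hZ u hu y, Finset.prod_comm, addChar_sum]
      refine Finset.prod_congr rfl fun j _ => ?_
      rw [Finset.mul_sum, Finset.sum_mul, addChar_sum]
      refine Finset.prod_congr rfl fun i _ => ?_
      rw [← hb i, AddChar.mulShift_apply]
      congr 1; ring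
    rw [hG, degeneracyPoly, map_sum, ← h1]
    refine Finset.sum_congr rfl fun j _ => ?_
    simp only [map_mul, map_pow, map_sum, MvPolynomial.eval_C, eval_genDiffCoeff]
  have hSZ := MvPolynomial.schwartz_zippel_sum_degreeOf hG0 fun _ => (Finset.univ : Finset K)
  have hSZ' := (NNRat.cast_le (K := ℝ)).mpr hSZ
  push_cast at hSZ'
  simp only [Finset.prod_const, Finset.card_univ, Fintype.card_fin] at hSZ'
  have hK : (0 : ℝ) < Fintype.card K := by exact_mod_cast Fintype.card_pos
  calc (Z.card : ℝ) / Fintype.card K ^ m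
      ≤ (Finset.card {x ∈ Fintype.piFinset fun _ : Fin m => (Finset.univ : Finset K) |
          MvPolynomial.eval x G = 0} : ℝ) / Fintype.card K ^ m := by
        gcongr
        intro u hu
        simp [hzero u hu]
    _ ≤ ∑ i : Fin m, ((G.degreeOf i : ℝ) / Fintype.card K) := hSZ'
    _ ≤ ∑ _i : Fin m, ((p : ℝ) ^ (2 * J) / Fintype.card K) := by
        refine Finset.sum_le_sum fun i _ => ?_
        gcongr
        exact_mod_cast degreeOf_degeneracyPoly_le hp hs hJ i
    _ = m * p ^ (2 * J) / Fintype.card K := by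
        rw [Finset.sum_const, Finset.card_univ, Fintype.card_fin, nsmul_eq_mul, mul_div_assoc]

end finiteField

/-! ### Weyl differencing -/

section weyl

open scoped BigOperators ComplexConjugate

variable {A B : Type*} [AddCommGroup A] [Fintype A] [AddCommGroup B] [Finite B]

lemma pow_expect_le {X : Type*} [Fintype X] [Nonempty X] (a : X → ℝ) (ha : ∀ x, 0 ≤ a x) (n : ℕ) :
    (𝔼 x, a x) ^ n ≤ 𝔼 x, a x ^ n := by
  have hc : (0 : ℝ) < Fintype.card X := by exact_mod_cast Fintype.card_pos
  have := Real.pow_arith_mean_le_arith_mean_pow Finset.univ (fun _ : X => (Fintype.card X : ℝ)⁻¹) a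
    (fun _ _ => by positivity) (by simp [hc.ne']) (fun x _ => ha x) n
  rw [Fintype.expect_eq_sum_div_card, Fintype.expect_eq_sum_div_card, div_eq_inv_mul,
    div_eq_inv_mul, Finset.mul_sum, Finset.mul_sum]
  exact this

/-- One step of Weyl differencing. -/
lemma norm_expect_sq_le (ψ : AddChar B ℂ) (g : A → B) :
    ‖𝔼 y, ψ (g y)‖ ^ 2 ≤ 𝔼 u, ‖𝔼 y, ψ (fwdDiff u g y)‖ := by
  have h1 : (𝔼 y, ψ (g y)) * conj (𝔼 y, ψ (g y)) = 𝔼 u, 𝔼 y, ψ (fwdDiff u g y) := by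
    have hc : conj (𝔼 y, ψ (g y)) = 𝔼 y, conj (ψ (g y)) := by
      rw [Fintype.expect_eq_sum_div_card, Fintype.expect_eq_sum_div_card]
      simp
    rw [hc, mul_comm, Fintype.expect_mul_expect, Finset.expect_comm (t := Finset.univ)]
    rw [Finset.expect_comm]
    conv_rhs => rw [Finset.expect_comm]
    refine Finset.expect_congr rfl fun y _ => ?_
    refine (Fintype.expect_equiv (Equiv.addLeft y) _ _ fun u => ?_).symm
    simp only [fwdDiff, Equiv.coe_addLeft]
    rw [sub_eq_add_neg, ψ.map_add_eq_mul, AddChar.map_neg_eq_conj, mul_comm]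
  have h2 : ‖𝔼 y, ψ (g y)‖ ^ 2 = ‖𝔼 u, 𝔼 y, ψ (fwdDiff u g y)‖ := by
    rw [← h1, norm_mul, RCLike.norm_conj, sq]
  rw [h2]
  exact RCLike.norm_expect_le (K := ℂ)

/-- Iterated Weyl differencing. -/
lemma norm_expect_pow_le (ψ : AddChar B ℂ) (m : ℕ) (g : A → B) :
    ‖𝔼 y, ψ (g y)‖ ^ 2 ^ m ≤ 𝔼 u : Fin m → A, ‖𝔼 y, ψ (iterFwdDiff m u g y)‖ := by
  induction m generalizing g with
  | zero => simp [iterFwdDiff]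
  | succ m ih =>
    calc ‖𝔼 y, ψ (g y)‖ ^ 2 ^ (m + 1) = (‖𝔼 y, ψ (g y)‖ ^ 2) ^ 2 ^ m := by
          rw [← pow_mul, pow_succ']
      _ ≤ (𝔼 u, ‖𝔼 y, ψ (fwdDiff u g y)‖) ^ 2 ^ m := by
          gcongr; exact norm_expect_sq_le ψ g
      _ ≤ 𝔼 u, ‖𝔼 y, ψ (fwdDiff u g y)‖ ^ 2 ^ m := pow_expect_le _ (fun _ => norm_nonneg _) _
      _ ≤ 𝔼 u, 𝔼 v : Fin m → A, ‖𝔼 y, ψ (iterFwdDiff m v (fwdDiff u g) y)‖ :=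
          Finset.expect_le_expect fun u _ => ih _
      _ = 𝔼 u : Fin (m + 1) → A, ‖𝔼 y, ψ (iterFwdDiff (m + 1) u g y)‖ := by
          rw [← Finset.expect_product', Finset.univ_product_univ]
          refine Fintype.expect_equiv (Fin.consEquiv fun _ => A) _ _ fun uv => ?_
          simp [iterFwdDiff, Fin.consEquiv]

end weyl

section ring

open scoped BigOperators

variable {A : Type*} [CommRing A] [Fintype A] {p : ℕ} [CharP A p] {ι : Type*}

open Classical in
/-- After `m` differences each `y ^ r i` of digit sum at most `m + 1` has become affine additive, so
that the character sum is bounded by the proportion of the increments for which the resulting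
additive character of `y` is trivial. -/
lemma norm_expect_prod_pow_le (hp : p.Prime) {m J : ℕ} (I : Finset ι) (χ : ι → AddChar A ℂ)
    (r : ι → ℕ) (hs : ∀ i ∈ I, digitSum p (r i) ≤ m + 1) (hJ : ∀ i ∈ I, r i < p ^ (J + 1)) :
    ‖𝔼 y, ∏ i ∈ I, χ i (y ^ r i)‖ ^ 2 ^ m ≤
      (Finset.card {u : Fin m → A | ∀ y, ∏ i ∈ I, ∏ j ∈ Finset.range (J + 1),
        χ i (diffCoeff m u (p ^ j) (r i) * y ^ p ^ j) = 1} : ℝ) / Fintype.card A ^ m := by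
  have : Fact p.Prime := ⟨hp⟩
  let ψ : AddChar (I → A) ℂ :=
    ∏ i : I, (χ i).compAddMonoidHom (Pi.evalAddMonoidHom (fun _ : I => A) i)
  have hψ : ∀ b, ψ b = ∏ i : I, χ i (b i) := fun b => by
    simp [ψ, AddChar.prod_apply]
  let g : A → I → A := fun y i => y ^ r i
  have hg : ∀ y, ∏ i ∈ I, χ i (y ^ r i) = ψ (g y) := fun y => by
    rw [hψ, ← Finset.prod_coe_sort I]
  simp_rw [hg]
  refine (norm_expect_pow_le ψ m g).trans ?_
  rw [Fintype.expect_eq_sum_div_card, Fintype.card_fun, Fintype.card_fin, Nat.cast_pow]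
  gcongr
  rw [Finset.card_filter, Nat.cast_sum]
  refine Finset.sum_le_sum fun u _ => ?_
  let θ : AddChar A ℂ := ∏ i ∈ I, ∏ j ∈ Finset.range (J + 1), (χ i).compAddMonoidHom
    ((AddMonoidHom.mulLeft (diffCoeff m u (p ^ j) (r i))).comp
      (iterateFrobenius A p j : A →+* A).toAddMonoidHom)
  have hθ : ∀ y, θ y = ∏ i ∈ I, ∏ j ∈ Finset.range (J + 1),
      χ i (diffCoeff m u (p ^ j) (r i) * y ^ p ^ j) := fun y => by
    simp [θ, AddChar.prod_apply, iterateFrobenius_def]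
  have hd : ∀ y, ψ (iterFwdDiff m u g y) = ψ (fun i => diffCoeff m u 0 (r i)) * θ y := by
    intro y
    have hcoord : ∀ i : I, iterFwdDiff m u g y i = iterFwdDiff m u (fun y => y ^ r i) y := fun i =>
      (congrFun (iterFwdDiff_comp_addMonoidHom (Pi.evalAddMonoidHom (fun _ : I => A) i) m u g)
        y).symm
    rw [hψ, hψ, hθ, ← Finset.prod_coe_sort I, ← Finset.prod_mul_distrib]
    refine Finset.prod_congr rfl fun i _ => ?_
    rw [hcoord, iterFwdDiff_pow_eq_additive hp (CharP.cast_eq_zero A p) m u (hs i i.2) (hJ i i.2),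
      AddChar.map_add_eq_mul, addChar_sum]
  simp_rw [hd]
  rw [← Finset.mul_expect, norm_mul, AddChar.norm_apply, one_mul, AddChar.expect_eq_ite]
  have hiff : θ = 0 ↔ ∀ y, ∏ i ∈ I, ∏ j ∈ Finset.range (J + 1),
      χ i (diffCoeff m u (p ^ j) (r i) * y ^ p ^ j) = 1 := by
    rw [AddChar.eq_zero_iff]
    simp_rw [hθ]
  by_cases h : θ = 0
  · rw [if_pos h, if_pos (hiff.mp h)]; simp
  · rw [if_neg h, if_neg (fun h' => h (hiff.mpr h'))]; simp

end ring

lemma card_mul_card_le_of_surjective {G H : Type*} [AddCommGroup G] [AddCommGroup H] [Fintype G]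
    [Fintype H] [DecidableEq H] (f : G →+ H) (hf : Function.Surjective f) (S : Finset G) :
    S.card * Fintype.card H ≤ (S.image f).card * Fintype.card G := by
  have hfib : ∀ h : H, Finset.card {g | f g = h} = Finset.card {g | f g = 0} := fun h =>
    AddMonoidHom.card_fiber_eq_of_mem_range f (hf h) (hf 0)
  set c := Finset.card {g | f g = 0} with hc
  have hG : Fintype.card G = c * Fintype.card H := by
    rw [← Finset.card_univ, Finset.card_eq_sum_card_fiberwise (f := f) (t := Finset.univ)
      (fun _ _ => Finset.mem_univ _), Finset.sum_congr rfl fun h _ => hfib h]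
    simp [mul_comm]
  have h1 : S.card ≤ c * (S.image f).card := by
    refine Finset.card_le_mul_card_image S c fun h _ => ?_
    rw [← hfib h]
    exact Finset.card_le_card (Finset.filter_subset_filter _ (Finset.subset_univ S))
  calc S.card * Fintype.card H ≤ c * (S.image f).card * Fintype.card H :=
        Nat.mul_le_mul_right _ h1
    _ = _ := by rw [hG]; ring

/-! ### Reduction from `F[t]_Q` to a residue field -/

section quotient

variable {F : Type*} [Field F]

/-- A family of characters of `F[t]_Q` that are not all trivial has a joint annihilator `R * T` in
`F[t]`, with `R` irreducible. Multiplication by `T` moves it to characters of the residue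
field `F[t] / R`, again not all trivial. -/
lemma exists_characters_of_residueField {Q : F[X]} (hQ : Q.Monic) {ι : Type*} (I : Finset ι)
    (χ : ι → AddChar (QuotRing Q) ℂ) {i₁ : ι} (hi₁ : i₁ ∈ I) (hχ : χ i₁ ≠ 1) :
    ∃ R T : F[X], R.Monic ∧ Irreducible R ∧ R ∣ Q ∧ ∃ τ : ι → AddChar (QuotRing R) ℂ,
      (∀ i ∈ I, ∀ a, τ i (modQ R a) = χ i (modQ Q (T * a))) ∧ ∃ i₀ ∈ I, τ i₀ ≠ 1 := by
  let ann : Ideal F[X] :=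
    { carrier := {a | ∀ i ∈ I, ∀ b, χ i (modQ Q (a * b)) = 1}
      add_mem' := fun {a a'} ha ha' i hi b => by
        rw [add_mul, map_add, AddChar.map_add_eq_mul, ha i hi, ha' i hi, one_mul]
      zero_mem' := fun i _ b => by simp
      smul_mem' := fun c a ha i hi b => by
        rw [smul_eq_mul, mul_comm c, mul_assoc]; exact ha i hi _ }
  have hann : ∀ a, a ∈ ann ↔ ∀ i ∈ I, ∀ b, χ i (modQ Q (a * b)) = 1 := fun a => Iff.rfl
  obtain ⟨S, hS⟩ : ∃ S, ann = Ideal.span {S} := (IsPrincipalIdealRing.principal ann).principal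
  have hmem : ∀ a, a ∈ ann ↔ S ∣ a := fun a => by rw [hS, Ideal.mem_span_singleton]
  have hSQ : S ∣ Q := by
    rw [← hmem]
    intro i _ b
    have : modQ Q (Q * b) = 0 :=
      Ideal.Quotient.eq_zero_iff_mem.mpr (Ideal.mem_span_singleton.mpr (dvd_mul_right Q b))
    rw [this, AddChar.map_zero_eq_one]
  have hSu : ¬ IsUnit S := by
    intro hu
    apply hχ
    ext x
    obtain ⟨a, rfl⟩ := Ideal.Quotient.mk_surjective x
    have := (hann 1).mp ((hmem 1).mpr hu.dvd) i₁ hi₁ a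
    rwa [one_mul] at this
  have hS0 : S ≠ 0 := fun h => hQ.ne_zero (zero_dvd_iff.mp (h ▸ hSQ))
  obtain ⟨R, hRm, hR, T, hT⟩ := Polynomial.exists_monic_irreducible_factor S hSu
  have hT0 : T ≠ 0 := by rintro rfl; rw [mul_zero] at hT; exact hS0 hT
  have hTann : T ∉ ann := by
    rw [hmem, hT]
    rintro ⟨c, hc⟩
    exact hR.not_isUnit (IsUnit.of_mul_eq_one c
      (mul_left_cancel₀ hT0 (by linear_combination -hc)))
  have hRT : ∀ i ∈ I, ∀ a a', modQ R a = modQ R a' →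
      χ i (modQ Q (T * a)) = χ i (modQ Q (T * a')) := by
    intro i hi a a' h
    rw [Ideal.Quotient.eq, Ideal.mem_span_singleton] at h
    obtain ⟨c, hc⟩ := h
    have h1 := (hann S).mp ((hmem S).mpr dvd_rfl) i hi c
    have h2 : T * a = S * c + T * a' := by rw [hT]; linear_combination T * hc
    rw [h2, map_add, AddChar.map_add_eq_mul, h1, one_mul]
  have hτ : ∀ i, ∃ τ : AddChar (QuotRing R) ℂ,
      i ∈ I → ∀ a, τ (modQ R a) = χ i (modQ Q (T * a)) := by
    intro i
    by_cases hi : i ∈ I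
    · have hsurj : Function.Surjective (modQ R) := Ideal.Quotient.mk_surjective
      have hinv := Function.surjInv_eq hsurj
      refine ⟨⟨fun z => χ i (modQ Q (T * Function.surjInv hsurj z)), ?_, ?_⟩, fun _ a => ?_⟩
      · rw [hRT i hi _ 0 (by rw [hinv, map_zero])]; simp
      · intro z z'
        rw [hRT i hi _ (Function.surjInv hsurj z + Function.surjInv hsurj z')
          (by rw [map_add, hinv, hinv, hinv]), mul_add, map_add, AddChar.map_add_eq_mul]
      · exact hRT i hi _ _ (hinv _)
    · exact ⟨1, fun h => absurd h hi⟩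
  choose τ hτ using hτ
  refine ⟨R, T, hRm, hR, (Dvd.intro T hT.symm).trans hSQ, τ, hτ, ?_⟩
  rw [hann] at hTann
  push Not at hTann
  obtain ⟨i₀, hi₀, a, ha⟩ := hTann
  exact ⟨i₀, hi₀, fun h => ha (by rw [← hτ i₀ hi₀, h, AddChar.one_apply])⟩

lemma card_quotRing {R : F[X]} (hR : R.Monic) :
    Nat.card (QuotRing R) = Nat.card F ^ R.natDegree := by
  have : Module.Finite F (QuotRing R) := hR.finite_quotient
  rw [Module.natCard_eq_pow_finrank (K := F), finrank_quotient_span_eq_natDegree]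

open Classical in
/-- The proportion of degenerate increments in `F[t]_Q` is at most that in a residue field. -/
lemma card_degenerate_quotRing_le [Finite F] {p : ℕ} (hp : p.Prime) [CharP F p] {Q : F[X]} (hQ : Q.Monic)
    [Fintype (QuotRing Q)] {m J : ℕ} {ι : Type*} {I : Finset ι} {r : ι → ℕ}
    (hr : ∀ i ∈ I, ¬ p ∣ r i) (hinj : Function.Injective r)
    (hs : ∀ i ∈ I, digitSum p (r i) = m + 1) (hJ : ∀ i ∈ I, r i < p ^ (J + 1))
    (χ : ι → AddChar (QuotRing Q) ℂ) {i₁ : ι} (hi₁ : i₁ ∈ I) (hχ : χ i₁ ≠ 1) :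
    ∃ R : F[X], R.Monic ∧ Irreducible R ∧ R ∣ Q ∧
      (Finset.card {u : Fin m → QuotRing Q | ∀ y, ∏ i ∈ I, ∏ j ∈ Finset.range (J + 1),
        χ i (diffCoeff m u (p ^ j) (r i) * y ^ p ^ j) = 1} : ℝ) / Fintype.card (QuotRing Q) ^ m ≤
      m * p ^ (2 * J) / polyAbs R := by
  obtain ⟨R, T, hRm, hR, hRQ, τ, hτ, i₀, hi₀, hτ₀⟩ :=
    exists_characters_of_residueField hQ I χ hi₁ hχ
  refine ⟨R, hRm, hR, hRQ, ?_⟩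
  have : (Ideal.span {R}).IsMaximal := PrincipalIdealRing.isMaximal_of_irreducible hR
  let _ : Field (QuotRing R) := Ideal.Quotient.field _
  have : Finite (QuotRing R) := finite_quotRing hRm
  have : Fintype (QuotRing R) := Fintype.ofFinite _
  have : CharP (QuotRing R) p := charP_of_injective_algebraMap (algebraMap F (QuotRing R)).injective p
  let π : QuotRing Q →+* QuotRing R :=
    Ideal.Quotient.factor (Ideal.span_singleton_le_span_singleton.mpr hRQ)
  have hπ : ∀ a, π (modQ Q a) = modQ R a := fun a => Ideal.Quotient.factor_mk _ a
  have hπs : Function.Surjective π := Ideal.Quotient.factor_surjective _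
  set Z : Finset (Fin m → QuotRing Q) := {u | ∀ y, ∏ i ∈ I, ∏ j ∈ Finset.range (J + 1),
        χ i (diffCoeff m u (p ^ j) (r i) * y ^ p ^ j) = 1} with hZ
  let f : (Fin m → QuotRing Q) →+ (Fin m → QuotRing R) := π.toAddMonoidHom.compLeft (Fin m)
  have hf : Function.Surjective f := hπs.comp_left
  have h1 := card_mul_card_le_of_surjective f hf Z
  -- Substituting `T * a` for `y` turns the coefficient `N` of `y ^ p ^ j` into `T * T ^ (p ^ j - 1) * N`;
  -- the first factor `T` is absorbed by `τ`, and the second one is `1` for `j = 0`.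
  have h2 := card_degenerate_le hp hr hinj hs hJ τ hi₀ hτ₀
    (c := fun j => modQ R (T ^ (p ^ j - 1))) (by simp) (Z.image f) (by
      intro v hv y
      obtain ⟨u, hu, rfl⟩ := Finset.mem_image.mp hv
      obtain ⟨a, rfl⟩ := Ideal.Quotient.mk_surjective y
      rw [hZ, Finset.mem_filter] at hu
      rw [← hu.2 (modQ Q (T * a))]
      refine Finset.prod_congr rfl fun i hi => Finset.prod_congr rfl fun j _ => ?_
      have h3 : diffCoeff m (f u) (p ^ j) (r i) = π (diffCoeff m u (p ^ j) (r i)) :=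
        (map_diffCoeff π m u _ _).symm
      obtain ⟨n, hn⟩ := Ideal.Quotient.mk_surjective (diffCoeff m u (p ^ j) (r i))
      rw [h3, ← hn, hπ, ← map_pow, ← map_mul, ← map_mul, hτ i hi, ← map_pow, ← map_mul]
      congr 2
      have h4 : T ^ p ^ j = T * T ^ (p ^ j - 1) := by
        rw [← pow_succ', Nat.sub_add_cancel (Nat.one_le_pow _ _ hp.pos)]
      rw [mul_pow, h4]; ring)
  have h5 : (Fintype.card (QuotRing R) : ℝ) = polyAbs R := by
    rw [polyAbs, if_neg hRm.ne_zero, ← card_quotRing hRm, Nat.card_eq_fintype_card]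
  rw [← h5]
  refine le_trans ?_ h2
  simp only [Fintype.card_fun, Fintype.card_fin] at h1
  have hA : (0 : ℝ) < Fintype.card (QuotRing Q) := by exact_mod_cast Fintype.card_pos
  have hK : (0 : ℝ) < Fintype.card (QuotRing R) := by exact_mod_cast Fintype.card_pos
  rw [div_le_div_iff₀ (by positivity) (by positivity)]
  exact_mod_cast h1

end quotient

/-! ### The derivational degree and digit sums -/

section derivationalDegree

variable {L : Type*} [Field L]

lemma iterDiff_eq_iterFwdDiff (us : List L) (g : L → L) :
    iterDiff us g = iterFwdDiff us.length us.get g := by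
  rw [← iterDiff_ofFn, List.ofFn_get]

lemma iterFwdDiff_eval {m N : ℕ} (P : L[X]) (hN : P.natDegree < N) (u : Fin m → L) (y : L) :
    iterFwdDiff m u (fun x => P.eval x) y =
      ∑ n ∈ Finset.range N, P.coeff n * ∑ l ∈ Finset.range N, diffCoeff m u l n * y ^ l := by
  have h : (fun x => P.eval x) = fun x => ∑ n ∈ Finset.range N,
      AddMonoidHom.mulLeft (P.coeff n) (x ^ n) := by
    funext x
    rw [eval_eq_sum_range' hN]; rfl
  rw [h, iterFwdDiff_finset_sum]
  refine Finset.sum_congr rfl fun n hn => ?_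
  rw [iterFwdDiff_comp_addMonoidHom]
  dsimp only
  rw [iterFwdDiff_pow (Finset.mem_range.mp hn)]
  rfl

lemma iterDiff_zero (us : List L) : iterDiff us (fun _ => (0 : L)) = fun _ => 0 := by
  induction us with
  | nil => rfl
  | cons u us ih =>
    have : fwdDiff u (fun _ => (0 : L)) = fun _ => 0 := by funext x; simp [fwdDiff]
    change iterDiff us (fwdDiff u fun _ => 0) = _
    rw [this, ih]

lemma iterDiff_derivationalDegree (P : L[X]) {us : List L}
    (hus : us.length = derivationalDegree P + 1) (y : L) :
    iterDiff us (fun x => P.eval x) y = 0 := by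
  have hne : {m : ℕ | ∀ us : List L, us.length = m + 1 →
      ∀ y : L, iterDiff us (fun x => P.eval x) y = 0}.Nonempty := by
    refine ⟨P.natDegree, fun us hus y => ?_⟩
    rw [iterDiff_eq_iterFwdDiff, iterFwdDiff_eval P (Nat.lt_succ_self _)]
    refine Finset.sum_eq_zero fun n hn => ?_
    rw [Finset.sum_eq_zero, mul_zero]
    intro l _
    have := Finset.mem_range.mp hn
    rw [diffCoeff_eq_zero_of_lt _ _ (by omega), zero_mul]
  exact Nat.sInf_mem hne us hus y

/-- If `k + 1` differences annihilate `P`, then the exponents of `P` have digit sum at most `k`.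
The differences of the different monomials do not interfere, since they are homogeneous of different
degrees in the increments. -/
lemma digitSum_le_of_iterDiff_eq_zero [Infinite L] {p : ℕ} (hp : p.Prime) [CharP L p] {P : L[X]}
    {k : ℕ} (hk : ∀ us : List L, us.length = k + 1 → ∀ y, iterDiff us (fun x => P.eval x) y = 0)
    {n : ℕ} (hn : P.coeff n ≠ 0) : digitSum p n ≤ k := by
  by_contra! hlt
  -- With exactly `digitSum p n` differences the contribution of `y ^ n` is extremal.
  set m := digitSum p n with hm
  set N := P.natDegree + 1 with hN
  have hzero : ∀ u : Fin m → L, ∀ y, iterFwdDiff m u (fun x => P.eval x) y = 0 := by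
    intro u y
    rw [← iterDiff_ofFn]
    have hsplit : iterDiff (List.ofFn u) (fun x => P.eval x) =
        iterDiff ((List.ofFn u).drop (k + 1))
          (iterDiff ((List.ofFn u).take (k + 1)) fun x => P.eval x) := by
      rw [iterDiff, iterDiff, iterDiff, ← List.foldl_append, List.take_append_drop]
    have h0 : iterDiff ((List.ofFn u).take (k + 1)) (fun x => P.eval x) = fun _ => 0 :=
      funext fun y => hk _ (by simp; omega) y
    rw [hsplit, h0, iterDiff_zero]
  have hG : ∑ s ∈ Finset.range N, MvPolynomial.C (P.coeff s) * genDiffCoeff L m 0 s = 0 := by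
    refine MvPolynomial.funext fun u => ?_
    have h := hzero u 0
    rw [iterFwdDiff_eval P (Nat.lt_succ_self _)] at h
    rw [map_zero, ← h, map_sum]
    refine Finset.sum_congr rfl fun s _ => ?_
    rw [map_mul, MvPolynomial.eval_C, eval_genDiffCoeff, Finset.sum_range_succ']
    simp
  have hnN : n ∈ Finset.range N :=
    Finset.mem_range.mpr (Nat.lt_succ_of_le (le_natDegree_of_ne_zero hn))
  have h1 := congrArg (fun q => Polynomial.coeff (MvPolynomial.aeval
    (fun i => X * Polynomial.C (MvPolynomial.X i) : Fin m → (MvPolynomial (Fin m) L)[X]) q) n) hG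
  simp only [map_sum, map_mul, aeval_genDiffCoeff, map_zero, Polynomial.coeff_zero,
    Polynomial.finsetSum_coeff, Nat.sub_zero, MvPolynomial.algHom_C,
    Polynomial.algebraMap_apply, MvPolynomial.algebraMap_eq] at h1
  rw [Finset.sum_eq_single n] at h1
  · simp only [Polynomial.coeff_C_mul, Polynomial.coeff_mul_C, Polynomial.coeff_X_pow_self,
      one_mul] at h1
    rcases mul_eq_zero.mp h1 with h | h
    · exact hn (by simpa using h)
    · exact genDiffCoeff_ne_zero hp (Or.inl rfl) (by simp [hm]) h
  · intro s _ hs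
    simp [Polynomial.coeff_X_pow, Ne.symm hs]
  · exact fun h => absurd hnN h

lemma exists_eq_pow_of_isAdditive [Infinite L] {p : ℕ} (hp : p.Prime) [CharP L p] {η : L[X]}
    (hη : IsAdditive η) {n : ℕ} (hn : η.coeff n ≠ 0) : ∃ j, n = p ^ j := by
  have h1 : digitSum p n ≤ 1 := by
    refine digitSum_le_of_iterDiff_eq_zero hp (fun us hus y => ?_) hn
    obtain ⟨u, v, rfl⟩ := List.length_eq_two.mp hus
    simp [iterDiff, fwdDiff, hη _ _]
  have h0 : n ≠ 0 := by
    rintro rfl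
    apply hn
    have := hη 0 0
    rw [add_zero] at this
    rw [coeff_zero_eq_eval_zero]
    simpa using this
  have := digitSum_pos hp.one_lt (Nat.pos_of_ne_zero h0)
  exact eq_pow_of_digitSum_eq_one hp.one_lt (by omega)

end derivationalDegree

lemma eq_of_mul_pow_eq_mul_pow {p a b i j : ℕ} (hp : p.Prime) (ha : ¬ p ∣ a) (hb : ¬ p ∣ b)
    (h : a * p ^ i = b * p ^ j) : a = b := by
  wlog hij : i ≤ j generalizing a b i j
  · exact (this hb ha h.symm (by omega)).symm
  have h1 : a = b * p ^ (j - i) := by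
    refine Nat.eq_of_mul_eq_mul_right (pow_pos hp.pos i) ?_
    rw [h, mul_assoc, ← pow_add, Nat.sub_add_cancel hij]
  rcases Nat.eq_zero_or_pos (j - i) with h0 | h0
  · simpa [h0] using h1
  · exact absurd (h1 ▸ Dvd.dvd.mul_left (dvd_pow_self p h0.ne') b) ha

section decomposition

variable {F : Type*} [Field F]

lemma toLaurentInf_injective : Function.Injective (toLaurentInf F) :=
  ((algebraMap (RatFunc F) (LaurentInf F)).injective).comp
    (IsFractionRing.injective F[X] (RatFunc F))

instance : Infinite (LaurentInf F) := Infinite.of_injective _ (toLaurentInf_injective (F := F))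

lemma charP_laurentInf (p : ℕ) [CharP F p] : CharP (LaurentInf F) p :=
  charP_of_injective_ringHom (toLaurentInf_injective (F := F)) p

lemma eval_add_of_isAdditive {η : F[X][X]} (hη : IsAdditive (η.map (toLaurentInf F)))
    (x y : F[X]) : η.eval (x + y) = η.eval x + η.eval y := by
  apply toLaurentInf_injective
  have := hη (toLaurentInf F x) (toLaurentInf F y)
  rw [← map_add, eval_map_apply, eval_map_apply, eval_map_apply] at this
  rw [this, map_add]

/-- The exponents `r i * p ^ j` of the different summands `η i (y ^ r i)` are distinct. Hence no
cancellation takes place in their sum, and each nonzero summand is bounded in terms of `P`. -/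
lemma digitSum_le_and_le_natDegree {p : ℕ} (hp : p.Prime) [CharP F p] {P : F[X][X]} {a₀ : F[X]}
    {n : ℕ} {η : Fin n → F[X][X]} {r : Fin n → ℕ}
    (hη : ∀ i, IsAdditive ((η i).map (toLaurentInf F))) (hr : ∀ i, ¬ p ∣ r i)
    (hr_inj : Function.Injective r) (hPη : P = C a₀ + ∑ i, (η i).comp (X ^ r i)) {i : Fin n}
    (hi : η i ≠ 0) :
    digitSum p (r i) ≤ derivationalDegree (P.map (toLaurentInf F)) ∧ r i ≤ P.natDegree := by
  have := charP_laurentInf (F := F) p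
  have hsupp : ∀ i s, (η i).coeff s ≠ 0 → ∃ j, s = p ^ j := by
    intro i s hs
    refine exists_eq_pow_of_isAdditive hp (hη i) ?_
    rw [coeff_map]
    exact fun h => hs (toLaurentInf_injective (by rw [h, map_zero]))
  have hpos : ∀ i, 0 < r i := fun i => Nat.pos_of_ne_zero fun h => hr i (h ▸ dvd_zero p)
  obtain ⟨s, hs⟩ : ∃ s, (η i).coeff s ≠ 0 := by
    by_contra! h
    exact hi (Polynomial.ext h)
  obtain ⟨j, rfl⟩ := hsupp i s hs
  have hppos : 0 < p ^ j := pow_pos hp.pos j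
  have hcoeff : P.coeff (r i * p ^ j) = (η i).coeff (p ^ j) := by
    rw [hPη, coeff_add, coeff_C, if_neg (Nat.mul_pos (hpos i) hppos).ne', zero_add,
      finsetSum_coeff, Finset.sum_eq_single i]
    · rw [← expand_eq_comp_X_pow, mul_comm, coeff_expand_mul (hpos i)]
    · intro i' _ hne
      rw [← expand_eq_comp_X_pow, coeff_expand (hpos i')]
      split_ifs with hd
      · by_contra hc
        obtain ⟨l, hl⟩ := hsupp i' _ hc
        have h := Nat.mul_div_cancel' hd
        rw [hl] at h
        exact hne (hr_inj (eq_of_mul_pow_eq_mul_pow hp (hr i') (hr i) h))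
      · rfl
    · simp
  have hne : P.coeff (r i * p ^ j) ≠ 0 := by rwa [hcoeff]
  constructor
  · rw [← digitSum_mul_pow hp.one_lt (r i) j]
    refine digitSum_le_of_iterDiff_eq_zero hp
      (fun us hus y => iterDiff_derivationalDegree _ hus y) ?_
    rw [coeff_map]
    exact fun h => hne (toLaurentInf_injective (by rw [h, map_zero]))
  · exact (Nat.le_mul_of_pos_right _ hppos).trans (le_natDegree_of_ne_zero hne)

lemma derivationalDegree_pos {p : ℕ} (hp : p.Prime) [CharP F p] {P : F[X][X]}
    (hP : 0 < P.natDegree) : 0 < derivationalDegree (P.map (toLaurentInf F)) := by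
  have := charP_laurentInf (F := F) p
  refine (digitSum_pos hp.one_lt hP).trans_le (digitSum_le_of_iterDiff_eq_zero hp
    (fun us hus y => iterDiff_derivationalDegree _ hus y) ?_)
  rw [coeff_map]
  intro h
  have h0 : P.leadingCoeff = 0 := toLaurentInf_injective (by rw [map_zero]; exact h)
  rw [leadingCoeff_eq_zero] at h0
  simp [h0] at hP

end decomposition

/-! ### Averages and Fourier multipliers -/

section fourier

open scoped BigOperators ComplexConjugate

variable {A : Type*} [AddCommGroup A] [Fintype A]

lemma avg_univ_eq_expect {X 𝕜 : Type*} [Fintype X] [Field 𝕜] [CharZero 𝕜] (g : X → 𝕜) :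
    avg Set.univ g = 𝔼 x, g x := by
  rw [avg, Fintype.expect_eq_sum_div_card, div_eq_inv_mul, Set.ncard_univ,
    Nat.card_eq_fintype_card]
  simp [finsum_eq_sum_of_fintype]

open Classical in
lemma avg_eq_expect {X 𝕜 : Type*} [Fintype X] [Field 𝕜] [CharZero 𝕜] (S : Set X) (g : X → 𝕜) :
    avg S g = 𝔼 x ∈ S.toFinset, g x := by
  rw [avg, Finset.expect_eq_sum_div_card, div_eq_inv_mul, Set.ncard_eq_toFinset_card',
    finsum_mem_eq_toFinset_sum]

lemma lrNorm_two_eq {X : Type*} [Fintype X] (g : X → ℂ) :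
    lrNorm 2 g = Real.sqrt (𝔼 x, ‖g x‖ ^ 2) := by
  rw [lrNorm, avg_univ_eq_expect, Real.sqrt_eq_rpow]
  norm_num

/-- Parseval's identity. -/
lemma expect_norm_sq_sum_addChar (c : AddChar A ℂ → ℂ) :
    𝔼 x, ‖∑ χ, c χ * χ x‖ ^ 2 = ∑ χ, ‖c χ‖ ^ 2 := by
  have h : ((𝔼 x, ‖∑ χ, c χ * χ x‖ ^ 2 : ℝ) : ℂ) = ((∑ χ, ‖c χ‖ ^ 2 : ℝ) : ℂ) := by
    rw [Fintype.expect_eq_sum_div_card]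
    push_cast
    rw [← Fintype.expect_eq_sum_div_card]
    simp_rw [← Complex.mul_conj', map_sum, map_mul, Finset.sum_mul_sum]
    rw [Finset.expect_sum_comm]
    refine Finset.sum_congr rfl fun χ _ => ?_
    rw [Finset.expect_sum_comm, Finset.sum_eq_single χ]
    · have : ∀ x, c χ * χ x * (conj (c χ) * conj (χ x)) = c χ * conj (c χ) := fun x => by
        rw [← AddChar.map_neg_eq_conj, mul_mul_mul_comm, ← χ.map_add_eq_mul]; simp
      simp_rw [this]
      exact Fintype.expect_const _
    · intro χ' _ hne
      have h1 : ∀ x, c χ * χ x * (conj (c χ') * conj (χ' x)) =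
          c χ * conj (c χ') * (χ - χ') x := fun x => by
        rw [← AddChar.map_neg_eq_conj, mul_mul_mul_comm, AddChar.sub_apply]
      simp_rw [h1]
      rw [← Finset.mul_expect, AddChar.expect_eq_zero_iff_ne_zero.mpr (sub_ne_zero.mpr hne.symm),
        mul_zero]
    · simp
  exact_mod_cast h

/-- A linear operator on `L²(A)` that is diagonalised by the characters is bounded by the largest
absolute value of its eigenvalues. -/
lemma lrNorm_two_le_of_multiplier (T : (A → ℂ) →ₗ[ℂ] (A → ℂ)) (μ : AddChar A ℂ → ℂ)
    (hT : ∀ χ : AddChar A ℂ, T χ = μ χ • (χ : A → ℂ)) {M : ℝ} (hM : 0 ≤ M)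
    (hμ : ∀ χ, ‖μ χ‖ ≤ M) (f : A → ℂ) : lrNorm 2 (T f) ≤ M * lrNorm 2 f := by
  set c := (AddChar.complexBasis A).repr f with hc
  have hf : f = ∑ χ, c χ • (χ : A → ℂ) := by
    conv_lhs => rw [← (AddChar.complexBasis A).sum_repr f]
    simp [hc]
  have hTf : T f = ∑ χ, (c χ * μ χ) • (χ : A → ℂ) := by
    rw [hf, map_sum]
    simp_rw [map_smul, hT, smul_smul]
  have h1 : 𝔼 x, ‖f x‖ ^ 2 = ∑ χ, ‖c χ‖ ^ 2 := by
    rw [← expect_norm_sq_sum_addChar]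
    conv_lhs => rw [hf]
    simp
  have h2 : 𝔼 x, ‖T f x‖ ^ 2 = ∑ χ, ‖c χ * μ χ‖ ^ 2 := by
    rw [← expect_norm_sq_sum_addChar fun χ => c χ * μ χ, hTf]
    simp
  rw [lrNorm_two_eq, lrNorm_two_eq, h1, h2]
  refine Real.sqrt_le_iff.mpr ⟨by positivity, ?_⟩
  rw [mul_pow, Real.sq_sqrt (by positivity), Finset.mul_sum]
  refine Finset.sum_le_sum fun χ _ => ?_
  rw [norm_mul, mul_pow, mul_comm]
  gcongr
  exact hμ χ

open Classical in
lemma expect_addSubgroup_eq_zero (H : AddSubgroup A) (χ : AddChar A ℂ) {z₀ : A} (hz₀ : z₀ ∈ H)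
    (hχ : χ z₀ ≠ 1) : 𝔼 z ∈ (H : Set A).toFinset, χ z = 0 := by
  rw [Finset.expect_eq_sum_div_card]
  have h : ∑ z ∈ (H : Set A).toFinset, χ z = χ z₀ * ∑ z ∈ (H : Set A).toFinset, χ z := by
    rw [Finset.mul_sum]
    refine (Finset.sum_equiv (Equiv.addLeft z₀) (fun z => ?_) fun z _ => ?_).symm
    · simp [H.add_mem_cancel_left hz₀]
    · simp [χ.map_add_eq_mul]
  have h0 : (χ z₀ - 1) * ∑ z ∈ (H : Set A).toFinset, χ z = 0 := by linear_combination -h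
  rcases mul_eq_zero.mp h0 with h1 | h1
  · exact absurd (sub_eq_zero.mp h1) hχ
  · rw [h1, zero_div]

end fourier

/-! ### Character sums over `F[t]_Q` -/

section characterSum

open scoped BigOperators

variable {F : Type*} [Field F]

/-- The additive map of `F[t]_Q` given by an additive polynomial. -/
noncomputable def additiveHom {η : F[X][X]} (hη : IsAdditive (η.map (toLaurentInf F))) (Q : F[X]) :
    QuotRing Q →+ QuotRing Q :=
  AddMonoidHom.mk' (fun y => (η.map (modQ Q)).eval y) fun x y => by
    obtain ⟨a, rfl⟩ := Ideal.Quotient.mk_surjective x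
    obtain ⟨b, rfl⟩ := Ideal.Quotient.mk_surjective y
    rw [← map_add, eval_map_apply, eval_map_apply, eval_map_apply, eval_add_of_isAdditive hη,
      map_add]

lemma additiveHom_apply {η : F[X][X]} (hη : IsAdditive (η.map (toLaurentInf F))) (Q : F[X])
    (y : QuotRing Q) : additiveHom hη Q y = (η.map (modQ Q)).eval y := rfl

/-- The image of `imageSum η` in `F[t]_Q`, as a subgroup. -/
noncomputable def imageSubgroup {n : ℕ} {η : Fin n → F[X][X]}
    (hη : ∀ i, IsAdditive ((η i).map (toLaurentInf F))) (Q : F[X]) : AddSubgroup (QuotRing Q) :=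
  (∑ i, (additiveHom (hη i) Q).comp (Pi.evalAddMonoidHom (fun _ => QuotRing Q) i)).range

lemma mem_imageSubgroup {n : ℕ} {η : Fin n → F[X][X]}
    (hη : ∀ i, IsAdditive ((η i).map (toLaurentInf F))) (Q : F[X]) (z : QuotRing Q) :
    z ∈ imageSubgroup hη Q ↔
      ∃ y : Fin n → QuotRing Q, ∑ i, ((η i).map (modQ Q)).eval (y i) = z := by
  simp [imageSubgroup, AddMonoidHom.mem_range, additiveHom_apply]

lemma image_imageSum {n : ℕ} {η : Fin n → F[X][X]}
    (hη : ∀ i, IsAdditive ((η i).map (toLaurentInf F))) (Q : F[X]) :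
    modQ Q '' imageSum η = imageSubgroup hη Q := by
  ext z
  rw [SetLike.mem_coe, mem_imageSubgroup]
  constructor
  · rintro ⟨_, ⟨y, rfl⟩, rfl⟩
    exact ⟨fun i => modQ Q (y i), by simp only [map_sum, eval_map_apply]⟩
  · rintro ⟨y, rfl⟩
    choose a ha using fun i => Ideal.Quotient.mk_surjective (y i)
    exact ⟨∑ i, (η i).eval (a i), ⟨a, rfl⟩, by simp only [map_sum, ← ha, eval_map_apply]⟩

lemma lpf_pos_and_le [Finite F] {Q R : F[X]} (hR : R.Monic) (hRi : Irreducible R) (hRQ : R ∣ Q) :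
    0 < lpf Q ∧ lpf Q ≤ polyAbs R := by
  have hmem : polyAbs R ∈ {m : ℕ | ∃ R : F[X], R.Monic ∧ Irreducible R ∧ R ∣ Q ∧ polyAbs R = m} :=
    ⟨R, hR, hRi, hRQ, rfl⟩
  refine ⟨?_, Nat.sInf_le hmem⟩
  obtain ⟨R', hR', _, _, h⟩ := Nat.sInf_mem ⟨_, hmem⟩
  have h' : polyAbs R' = lpf Q := h
  rw [← h', polyAbs, if_neg hR'.ne_zero]
  exact pow_pos Nat.card_pos _

/-- Weyl's bound for a character sum: a family of characters that are not all trivial, evaluated at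
the distinct powers `y ^ r i` with the `r i` prime to `p`. -/
lemma norm_expect_prod_pow_le_lpf [Finite F] {p : ℕ} (hp : p.Prime) [CharP F p] {Q : F[X]}
    (hQ : Q.Monic) [Fintype (QuotRing Q)] {ι : Type*} {I : Finset ι} (hI : I.Nonempty)
    {r : ι → ℕ} (hr : ∀ i ∈ I, ¬ p ∣ r i) (hinj : Function.Injective r) {k d : ℕ}
    (hk : ∀ i ∈ I, digitSum p (r i) ≤ k) (hd : ∀ i ∈ I, r i ≤ d)
    (χ : ι → AddChar (QuotRing Q) ℂ) (hχ : ∀ i ∈ I, χ i ≠ 1) :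
    ‖𝔼 y, ∏ i ∈ I, χ i (y ^ r i)‖ ^ 2 ^ (k - 1) ≤
      (p : ℝ) ^ (2 * Nat.log p d) * (((k : ℝ) - 1) / (lpf Q : ℝ)) := by
  classical
  -- Only the exponents of the largest digit sum `m + 1` survive `m` differences.
  obtain ⟨i₁, hi₁, hmax⟩ := I.exists_max_image (fun i => digitSum p (r i)) hI
  have hr₁ : 0 < r i₁ := Nat.pos_of_ne_zero fun h => hr i₁ hi₁ (h ▸ dvd_zero p)
  obtain ⟨m, hm⟩ : ∃ m, digitSum p (r i₁) = m + 1 :=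
    Nat.exists_eq_succ_of_ne_zero (digitSum_pos hp.one_lt hr₁).ne'
  have hmk : m + 1 ≤ k := hm ▸ hk i₁ hi₁
  set J := Nat.log p d with hJdef
  have hJ : ∀ i ∈ I, r i < p ^ (J + 1) := fun i hi =>
    (hd i hi).trans_lt (Nat.lt_pow_succ_log_self hp.one_lt d)
  have hs : ∀ i ∈ I, digitSum p (r i) ≤ m + 1 := fun i hi => hm ▸ hmax i hi
  have : Nontrivial (QuotRing Q) := by
    by_contra hne
    rw [not_nontrivial_iff_subsingleton] at hne
    exact hχ i₁ hi₁ (AddChar.ext _ _ fun x => by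
      rw [Subsingleton.elim x 0, AddChar.map_zero_eq_one, AddChar.one_apply])
  have : CharP (QuotRing Q) p :=
    charP_of_injective_algebraMap (algebraMap F (QuotRing Q)).injective p
  set I' := I.filter fun i => digitSum p (r i) = m + 1 with hI'
  have hI'I : ∀ i ∈ I', i ∈ I := fun i hi => (Finset.mem_filter.mp hi).1
  have h1 := norm_expect_prod_pow_le hp (m := m) I χ r hs hJ
  have hprod : ∀ (u : Fin m → QuotRing Q) (y : QuotRing Q),
      ∏ i ∈ I, ∏ j ∈ Finset.range (J + 1), χ i (diffCoeff m u (p ^ j) (r i) * y ^ p ^ j) =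
      ∏ i ∈ I', ∏ j ∈ Finset.range (J + 1), χ i (diffCoeff m u (p ^ j) (r i) * y ^ p ^ j) := by
    intro u y
    refine (Finset.prod_subset (Finset.filter_subset _ _) fun i hi hi' => ?_).symm
    refine Finset.prod_eq_one fun j _ => ?_
    have hlt : digitSum p (r i) < m + 1 :=
      lt_of_le_of_ne (hs i hi) fun h => hi' (Finset.mem_filter.mpr ⟨hi, h⟩)
    rw [diffCoeff_eq_zero hp (CharP.cast_eq_zero _ p) m u
      (by rw [digitSum_pow hp.one_lt]; omega), zero_mul, AddChar.map_zero_eq_one]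
  simp_rw [hprod] at h1
  obtain ⟨R, hRm, hRi, hRQ, h2⟩ := card_degenerate_quotRing_le hp hQ (m := m) (J := J) (I := I')
    (r := r) (fun i hi => hr i (hI'I i hi)) hinj (fun i hi => (Finset.mem_filter.mp hi).2)
    (fun i hi => hJ i (hI'I i hi)) χ (Finset.mem_filter.mpr ⟨hi₁, hm⟩) (hχ i₁ hi₁)
  obtain ⟨hlpf, hle⟩ := lpf_pos_and_le hRm hRi hRQ
  have hE : ‖𝔼 y, ∏ i ∈ I, χ i (y ^ r i)‖ ≤ 1 := by
    refine (RCLike.norm_expect_le (K := ℂ)).trans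
      (Finset.expect_le Finset.univ_nonempty fun y _ => ?_)
    rw [norm_prod]
    exact (Finset.prod_eq_one fun i _ => AddChar.norm_apply _ _).le
  have hmk' : (m : ℝ) ≤ (k : ℝ) - 1 := by
    have : ((m + 1 : ℕ) : ℝ) ≤ k := by exact_mod_cast hmk
    push_cast at this; linarith
  have hlpf' : (0 : ℝ) < lpf Q := by exact_mod_cast hlpf
  calc ‖𝔼 y, ∏ i ∈ I, χ i (y ^ r i)‖ ^ 2 ^ (k - 1)
      ≤ ‖𝔼 y, ∏ i ∈ I, χ i (y ^ r i)‖ ^ 2 ^ m :=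
        pow_le_pow_of_le_one (norm_nonneg _) hE (Nat.pow_le_pow_right two_pos (by omega))
    _ ≤ m * p ^ (2 * J) / polyAbs R := h1.trans h2
    _ ≤ m * p ^ (2 * J) / lpf Q := by gcongr
    _ ≤ ((k : ℝ) - 1) * p ^ (2 * J) / lpf Q := by gcongr
    _ = (p : ℝ) ^ (2 * J) * (((k : ℝ) - 1) / (lpf Q : ℝ)) := by ring

open Classical in
/-- The bound for the eigenvalue at the character `χ` of the operator that takes the difference of
the two averages. If `χ` is trivial on the subgroup, the eigenvalue vanishes. If not, the subgroup
average is `0`, and Weyl's bound applies to those `i` for which `χ ∘ η i` is nontrivial. -/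
lemma norm_expect_sub_expect_le [Finite F] {p : ℕ} (hp : p.Prime) [CharP F p] {P : F[X][X]}
    (hP : 0 < P.natDegree) {a₀ : F[X]} {n : ℕ} {η : Fin n → F[X][X]} {r : Fin n → ℕ}
    (hη : ∀ i, IsAdditive ((η i).map (toLaurentInf F))) (hr : ∀ i, ¬ p ∣ r i)
    (hr_inj : Function.Injective r) (hPη : P = C a₀ + ∑ i, (η i).comp (X ^ r i))
    {Q : F[X]} (hQ : Q.Monic) [Fintype (QuotRing Q)] (χ : AddChar (QuotRing Q) ℂ) {k : ℕ}
    (hk : derivationalDegree (P.map (toLaurentInf F)) = k) :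
    ‖𝔼 y, χ ((P.map (modQ Q)).eval y) -
      𝔼 z ∈ (imageSubgroup hη Q : Set (QuotRing Q)).toFinset, χ (modQ Q a₀ + z)‖ ≤
    ((p : ℝ) ^ (2 * Nat.log p P.natDegree) * (((k : ℝ) - 1) / (lpf Q : ℝ))) ^
      ((1 : ℝ) / 2 ^ (k - 1)) := by
  have hk1 : (1 : ℝ) ≤ k := by
    have := derivationalDegree_pos hp hP
    exact_mod_cast hk ▸ this
  have hB : 0 ≤ (p : ℝ) ^ (2 * Nat.log p P.natDegree) * (((k : ℝ) - 1) / (lpf Q : ℝ)) :=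
    mul_nonneg (by positivity) (div_nonneg (by linarith) (by positivity))
  let χ' : Fin n → AddChar (QuotRing Q) ℂ := fun i => χ.compAddMonoidHom (additiveHom (hη i) Q)
  let I : Finset (Fin n) := Finset.univ.filter fun i => χ' i ≠ 1
  have hI : ∀ i, i ∉ I → χ' i = 1 := fun i hi => by simpa [I] using hi
  have hPχ : ∀ y, χ ((P.map (modQ Q)).eval y) = χ (modQ Q a₀) * ∏ i ∈ I, χ' i (y ^ r i) := by
    intro y
    have h1 : (P.map (modQ Q)).eval y =
        modQ Q a₀ + ∑ i, additiveHom (hη i) Q (y ^ r i) := by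
      rw [hPη]
      simp [Polynomial.map_sum, Polynomial.map_comp, eval_finsetSum, additiveHom_apply]
    rw [h1, χ.map_add_eq_mul, addChar_sum]
    congr 1
    refine (Finset.prod_subset (Finset.subset_univ I) fun i _ hi => ?_).symm
    change χ' i (y ^ r i) = 1
    rw [hI i hi, AddChar.one_apply]
  simp_rw [hPχ, χ.map_add_eq_mul, ← Finset.mul_expect, ← mul_sub]
  rw [norm_mul, AddChar.norm_apply, one_mul]
  rcases I.eq_empty_or_nonempty with hI0 | hI0
  · -- All characters are trivial, so `χ` is trivial on the subgroup and both averages are `1`.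
    have hz : ∀ z ∈ (imageSubgroup hη Q : Set (QuotRing Q)).toFinset, χ z = 1 := by
      intro z hz
      rw [Set.mem_toFinset, SetLike.mem_coe, mem_imageSubgroup] at hz
      obtain ⟨y, rfl⟩ := hz
      rw [addChar_sum]
      refine Finset.prod_eq_one fun i _ => ?_
      change χ' i (y i) = 1
      rw [hI i (by simp [hI0]), AddChar.one_apply]
    rw [Finset.expect_congr rfl hz, hI0, Finset.expect_const]
    · simp only [Finset.prod_empty]
      rw [Fintype.expect_const, sub_self, norm_zero]
      positivity
    · exact ⟨0, by rw [Set.mem_toFinset]; exact (imageSubgroup hη Q).zero_mem⟩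
  · have hzero : 𝔼 z ∈ (imageSubgroup hη Q : Set (QuotRing Q)).toFinset, χ z = 0 := by
      obtain ⟨i, hi⟩ := hI0
      obtain ⟨y, hy⟩ := AddChar.ne_one_iff.mp (Finset.mem_filter.mp hi).2
      refine expect_addSubgroup_eq_zero _ χ (z₀ := additiveHom (hη i) Q y) ?_ hy
      rw [mem_imageSubgroup]
      refine ⟨Pi.single i y, ?_⟩
      rw [Finset.sum_eq_single i]
      · simp [additiveHom_apply]
      · intro j _ hj
        rw [Pi.single_eq_of_ne hj]
        exact (additiveHom (hη j) Q).map_zero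
      · simp
    rw [hzero, sub_zero]
    have hbound : ∀ i ∈ I, digitSum p (r i) ≤ k ∧ r i ≤ P.natDegree := by
      intro i hi
      rw [← hk]
      refine digitSum_le_and_le_natDegree hp hη hr hr_inj hPη fun h0 => ?_
      refine (Finset.mem_filter.mp hi).2 (AddChar.ext _ _ fun y => ?_)
      simp [χ', additiveHom_apply, h0]
    have h := norm_expect_prod_pow_le_lpf hp hQ hI0 (fun i _ => hr i) hr_inj
      (fun i hi => (hbound i hi).1) (fun i hi => (hbound i hi).2) χ'
      (fun i hi => (Finset.mem_filter.mp hi).2)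
    have hpow : ((1 : ℝ) / 2 ^ (k - 1)) = ((2 ^ (k - 1) : ℕ) : ℝ)⁻¹ := by push_cast; rw [one_div]
    rw [hpow]
    rw [Real.le_rpow_inv_iff_of_pos (norm_nonneg _) hB (by positivity), Real.rpow_natCast]
    exact h

end characterSum

end PolyWeyl

theorem mainTheorem1 {F : Type*} [Field F] [Finite F] (p : ℕ) [CharP F p]
    (P : F[X][X]) (d k : ℕ) (hP : 0 < P.natDegree) (hd : P.natDegree = d)
    (hk : PolyWeyl.derivationalDegree (P.map (PolyWeyl.toLaurentInf F)) = k)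
    (a₀ : F[X]) (n : ℕ) (η : Fin n → F[X][X]) (r : Fin n → ℕ)
    (hη : ∀ i, PolyWeyl.IsAdditive ((η i).map (PolyWeyl.toLaurentInf F)))
    (hr : ∀ i, ¬ p ∣ r i) (hr_inj : Function.Injective r)
    (hPη : P = C a₀ + ∑ i, (η i).comp (X ^ r i))
    (Q : F[X]) (hQ : Q.Monic) (f : PolyWeyl.QuotRing Q → ℂ) :
    PolyWeyl.lrNorm 2 (fun x : PolyWeyl.QuotRing Q =>
        PolyWeyl.avg Set.univ
          (fun y : PolyWeyl.QuotRing Q => f (x + (P.map (PolyWeyl.modQ Q)).eval y))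
        - PolyWeyl.avg (PolyWeyl.modQ Q '' PolyWeyl.imageSum η)
          (fun z => f (x + PolyWeyl.modQ Q a₀ + z)))
      ≤ ((p : ℝ) ^ (2 * Nat.log p d) * (((k : ℝ) - 1) / (PolyWeyl.lpf Q : ℝ)))
            ^ ((1 : ℝ) / 2 ^ (k - 1))
        * PolyWeyl.lrNorm 2 f := by
  classical
  subst hd
  have hp : p.Prime := CharP.char_is_prime F p
  have : Finite (PolyWeyl.QuotRing Q) := PolyWeyl.finite_quotRing hQ
  have : Fintype (PolyWeyl.QuotRing Q) := Fintype.ofFinite _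
  set H := (PolyWeyl.imageSubgroup hη Q : Set (PolyWeyl.QuotRing Q)).toFinset with hH
  let T : (PolyWeyl.QuotRing Q → ℂ) →ₗ[ℂ] (PolyWeyl.QuotRing Q → ℂ) :=
    { toFun := fun f x => (Finset.univ.expect fun y => f (x + (P.map (PolyWeyl.modQ Q)).eval y)) -
        H.expect fun z => f (x + PolyWeyl.modQ Q a₀ + z)
      map_add' := fun f g => by
        funext x
        simp only [Pi.add_apply, Finset.expect_add_distrib]
        ring
      map_smul' := fun c f => by
        funext x
        simp only [Pi.smul_apply, smul_eq_mul, ← Finset.mul_expect, RingHom.id_apply]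
        ring }
  have hTf : (fun x : PolyWeyl.QuotRing Q =>
      PolyWeyl.avg Set.univ
        (fun y : PolyWeyl.QuotRing Q => f (x + (P.map (PolyWeyl.modQ Q)).eval y))
      - PolyWeyl.avg (PolyWeyl.modQ Q '' PolyWeyl.imageSum η)
        (fun z => f (x + PolyWeyl.modQ Q a₀ + z))) = T f := by
    funext x
    rw [PolyWeyl.avg_univ_eq_expect, PolyWeyl.image_imageSum hη Q, PolyWeyl.avg_eq_expect]
    rfl
  have hμ := fun χ => PolyWeyl.norm_expect_sub_expect_le hp hP hη hr hr_inj hPη hQ χ hk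
  rw [hTf]
  refine PolyWeyl.lrNorm_two_le_of_multiplier T _ (fun χ => ?_) ((norm_nonneg _).trans (hμ 0)) hμ f
  funext x
  simp only [T, LinearMap.coe_mk, AddHom.coe_mk, Pi.smul_apply, smul_eq_mul, add_assoc,
    AddChar.map_add_eq_mul χ x, ← Finset.mul_expect, ← mul_sub]
  rw [mul_comm]
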